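/- Let $K$ be a field and let $(Q,\sigma)$ be a rooted tree quiver: a finite quiver whose underlying graph is a tree and which has a unique sink $\sigma$. For a vertex $x$, the finite lattice $L_Q(x)$ is defined recursively by $L_Q(x)=\prod_a J(L_Q(ta))$, the product over all arrows $a\colon ta\to x$, where $J(L)$ denotes the lattice of all order ideals (down-closed subsets, including $\emptyset$) of $L$ ordered by inclusion. For $M=(M_a)_a\in L_Q(x)$, the reduced quiver $c_M\colon Q_M\to Q$ is the rooted tree quiver over $Q$ defined recursively as follows: it has a root $\sigma_M$ lying over $x$, and for every $a$ and every maximal element $S$ of the ideal $M_a$ a copy of $Q_S$ is attached to $\sigma_M$ by one arrow, lying over $a$, from the root of $Q_S$ to $\sigma_M$. Representations are finite dimensional over $K$. For a map of quivers $f\colon Q'\to Q$, pullback is $(f^*W)_x=W_{f(x)}$, $(f^*W)_a=W_{f(a)}$, and pushforward is $(f_*V)_x=\bigoplus_{y\in f^{-1}(x)}V_y$, $(f_*V)_a=\sum_{b\in f^{-1}(a)}V_b$; the tensor product is taken pointwise; the support of $V$ is the set of vertices $x$ with $V_x\neq 0$. Let $\mathbb 1_{Q}$ be the representation with $K$ at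 every vertex and the identity at every arrow, and for $M\in L_Q(x)$ let $\mathbb 1_M:=c_{M*}\mathbb 1_{Q_M}$; the representations $\mathbb 1_M$, for all vertices $x$ and all $M\in L_Q(x)$, are the reduced representations of $Q$. Direct sums below are finite and may be empty. (1) Let $M\in L_Q(\sigma)$ and $c=c_M$. There are unique maps $\pi_*\colon L_{Q_M}(\sigma_M)\to L_Q(\sigma)$ and $\pi^*\colon L_Q(\sigma)\to L_{Q_M}(\sigma_M)$ such that, for every $A\in L_{Q_M}(\sigma_M)$, $\pi_*A$ is the only element $N$ of $L_Q(\sigma)$ for which there are morphisms $Q_N\to (Q_M)_A\to Q_N$ of quivers over $Q$ with composition the identity (where $(Q_M)_A$ is a quiver over $Q$ via $(Q_M)_A\to Q_M\to Q$), and such that $\pi_*A\le N\iff A\le\pi^*N$ for all $A$ and $N$. For every $N\in L_Q(\sigma)$, $$c^*\mathbb 1_N\;\simeq\;\mathbb 1_{\pi^*N}\oplus U,$$ where $U$ is a direct sum of reduced representations of $Q_M$ and $\sigma_M\notin\operatorname{supp}U$; and for every $A\in L_{Q_M}(\sigma_M)$, $$c_*\mathbb 1_A\;\simeq\;\mathbb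 1_{\pi_*A}\oplus U',$$ where $U'$ is a direct sum of reduced representations of $Q$ and $\sigma\notin\operatorname{supp}U'$. (2) For every vertex $x$ of $Q$ and all $M,N\in L_Q(x)$, $$\mathbb 1_M\otimes\mathbb 1_N\;\simeq\;\mathbb 1_{M\wedge N}\oplus U,$$ where $U$ is a direct sum of reduced representations of $Q$ and $x\notin\operatorname{supp}U$. -/

import Mathlib

open scoped TensorProduct

universe u v w w'

namespace RootedTreeReps

/-! ### Quivers and maps of directed graphs -/

/-- A finite quiver: finite sets of vertices and arrows, with tail and head functions. -/
structure FinQuiver : Type (u + 1) where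
  V : Type u
  A : Type u
  t : A → V
  h : A → V
  [finV : Finite V]
  [finA : Finite A]

attribute [instance] FinQuiver.finV FinQuiver.finA

/-- A map of directed graphs. -/
@[ext] structure QHom (Q' Q : FinQuiver.{u}) where
  onV : Q'.V → Q.V
  onA : Q'.A → Q.A
  map_t : ∀ a, Q.t (onA a) = onV (Q'.t a)
  map_h : ∀ a, Q.h (onA a) = onV (Q'.h a)

namespace QHom

def id (Q : FinQuiver.{u}) : QHom Q Q := ⟨fun x => x, fun a => a, fun _ => rfl, fun _ => rfl⟩

/-- `f.comp g` is `f` followed by `g`. -/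
def comp {Q₁ Q₂ Q₃ : FinQuiver.{u}} (f : QHom Q₁ Q₂) (g : QHom Q₂ Q₃) : QHom Q₁ Q₃ where
  onV x := g.onV (f.onV x)
  onA a := g.onA (f.onA a)
  map_t a := by rw [g.map_t, f.map_t]
  map_h a := by rw [g.map_h, f.map_h]

end QHom

/-- Rank equivalence of two quivers `c : Λ → Q` and `d : Γ → Q` over `Q`: there are morphisms
`Γ → Λ → Γ` of quivers over `Q` whose composition is the identity of `Γ`. -/
def RankEquiv {Q Λ Γ : FinQuiver.{u}} (c : QHom Λ Q) (d : QHom Γ Q) : Prop :=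
  ∃ (g : QHom Γ Λ) (k : QHom Λ Γ), g.comp c = d ∧ k.comp d = c ∧ g.comp k = QHom.id Γ

/-! ### Rooted tree quivers -/

namespace FinQuiver

/-- The simple graph underlying a quiver. -/
def underlying (Q : FinQuiver.{u}) : SimpleGraph Q.V :=
  SimpleGraph.fromRel fun x y => ∃ a, Q.t a = x ∧ Q.h a = y

/-- `(Q, σ)` is a rooted tree quiver: the underlying graph is a tree (so there are neither loops
nor multiple edges), and `σ` is the unique sink. -/
structure IsRootedTree (Q : FinQuiver.{u}) (σ : Q.V) : Prop where
  loopless : ∀ a, Q.t a ≠ Q.h a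
  simple : ∀ a b, s(Q.t a, Q.h a) = s(Q.t b, Q.h b) → a = b
  isTree : Q.underlying.IsTree
  sink : ∀ x, (∀ a, Q.t a ≠ x) ↔ x = σ

/-- `y` is a child of `x` if there is an arrow from `y` to `x`. -/
def Child (Q : FinQuiver.{u}) (y x : Q.V) : Prop := ∃ a, Q.t a = y ∧ Q.h a = x

variable {Q : FinQuiver.{u}} {σ : Q.V}

lemma underlying_adj {x y : Q.V} :
    Q.underlying.Adj x y ↔ x ≠ y ∧ (Q.Child x y ∨ Q.Child y x) := by
  simp [underlying, SimpleGraph.fromRel_adj, Child]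

/-- Sending an arrow to its unordered pair of end points. -/
lemma card_edgeSet (hl : ∀ a, Q.t a ≠ Q.h a)
    (hs : ∀ a b, s(Q.t a, Q.h a) = s(Q.t b, Q.h b) → a = b) :
    Nat.card Q.underlying.edgeSet = Nat.card Q.A := by
  symm
  refine Nat.card_congr (Equiv.ofBijective
    (fun a => ⟨s(Q.t a, Q.h a), ?_⟩) ⟨?_, ?_⟩)
  · rw [SimpleGraph.mem_edgeSet, underlying_adj]
    exact ⟨hl a, Or.inl ⟨a, rfl, rfl⟩⟩
  · intro a b hab
    exact hs a b (congrArg Subtype.val hab)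
  · rintro ⟨e, he⟩
    induction e using Sym2.ind with
    | _ x y =>
      rw [SimpleGraph.mem_edgeSet, underlying_adj] at he
      rcases he.2 with ⟨a, rfl, rfl⟩ | ⟨a, rfl, rfl⟩
      · exact ⟨a, rfl⟩
      · exact ⟨a, Subtype.ext Sym2.eq_swap⟩

/-- In a rooted tree quiver no two arrows have the same tail. -/
lemma IsRootedTree.t_injective (hQ : Q.IsRootedTree σ) : Function.Injective Q.t := by
  classical
  have := Fintype.ofFinite Q.V
  have := Fintype.ofFinite Q.A
  have h1 := hQ.isTree.card_edgeFinset
  have h2 := card_edgeSet hQ.loopless hQ.simple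
  rw [Nat.card_eq_fintype_card, Nat.card_eq_fintype_card, ← SimpleGraph.edgeFinset_card] at h2
  let f : Q.A → {x : Q.V // x ≠ σ} := fun a =>
    ⟨Q.t a, fun h => ((hQ.sink σ).2 rfl) a h⟩
  have hf : Function.Surjective f := by
    rintro ⟨x, hx⟩
    by_contra hcon
    exact hx ((hQ.sink x).1 fun a ha => hcon ⟨a, Subtype.ext ha⟩)
  have hc : Fintype.card Q.A = Fintype.card {x : Q.V // x ≠ σ} := by
    rw [Fintype.card_subtype_compl, Fintype.card_subtype_eq]
    omega
  have hb := (Fintype.bijective_iff_surjective_and_card f).2 ⟨hf, hc⟩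
  intro a b hab
  exact hb.1 (Subtype.ext hab)

/-- The distance to the root decreases along arrows. -/
lemma IsRootedTree.dist_lt (hQ : Q.IsRootedTree σ) (n : ℕ) :
    ∀ a, Q.underlying.dist σ (Q.t a) = n → Q.underlying.dist σ (Q.h a) < n := by
  induction n using Nat.strong_induction_on with
  | _ n ih =>
    intro a ha
    have hne : σ ≠ Q.t a := fun h => ((hQ.sink σ).2 rfl) a h.symm
    have hconn := hQ.isTree.connected
    obtain ⟨p, hp⟩ := hconn.exists_walk_length_eq_dist (Q.t a) σ
    rw [SimpleGraph.dist_comm, ha] at hp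
    cases p with
    | nil => exact absurd rfl hne
    | @cons _ y _ hadj p =>
      rw [SimpleGraph.Walk.length_cons] at hp
      have hy : Q.underlying.dist σ y < n := by
        have := SimpleGraph.dist_le p
        rw [SimpleGraph.dist_comm] at this
        omega
      rcases (underlying_adj.1 hadj).2 with ⟨b, hb, rfl⟩ | ⟨b, rfl, hb⟩
      · rw [hQ.t_injective hb.symm]; exact hy
      · have := ih _ hy b rfl
        rw [hb, ha] at this
        omega

/-- A rooted tree quiver has no infinite ascending chain of vertices. -/
lemma IsRootedTree.wf (hQ : Q.IsRootedTree σ) : WellFounded Q.Child := by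
  have key : ∀ y x, Relation.TransGen Q.Child y x →
      Q.underlying.dist σ x < Q.underlying.dist σ y := by
    intro y x h
    induction h with
    | single h => obtain ⟨a, rfl, rfl⟩ := h; exact hQ.dist_lt _ a rfl
    | tail _ h ih => obtain ⟨a, rfl, rfl⟩ := h; exact (hQ.dist_lt _ a rfl).trans ih
  have : Std.Irrefl (Relation.TransGen Q.Child) := ⟨fun x h => (key x x h).false⟩
  exact Subrelation.wf (fun h => Relation.TransGen.single h)
    (Finite.wellFounded_of_trans_of_irrefl (Relation.TransGen Q.Child))

/-- A criterion for rooted tree quivers. -/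
lemma isRootedTree_of (hinj : Function.Injective Q.t)
    (hsink : ∀ x, (∀ a, Q.t a ≠ x) ↔ x = σ) (hwf : WellFounded Q.Child)
    (hreach : ∀ x, Q.underlying.Reachable x σ) : Q.IsRootedTree σ := by
  classical
  have hl : ∀ a, Q.t a ≠ Q.h a := fun a ha =>
    hwf.asymmetric (Q.t a) (Q.h a) ⟨a, rfl, rfl⟩ ⟨a, ha, ha.symm⟩
  have hs : ∀ a b, s(Q.t a, Q.h a) = s(Q.t b, Q.h b) → a = b := by
    intro a b hab
    rcases Sym2.eq_iff.1 hab with ⟨h, -⟩ | ⟨h1, h2⟩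
    · exact hinj h
    · exact (hwf.asymmetric (Q.t a) (Q.h a) ⟨a, rfl, rfl⟩ ⟨b, h2.symm, h1.symm⟩).elim
  refine ⟨hl, hs, ?_, hsink⟩
  rw [SimpleGraph.isTree_iff_connected_and_card]
  refine ⟨?_, ?_⟩
  · have : Nonempty Q.V := ⟨σ⟩
    exact ⟨fun x y => (hreach x).trans (hreach y).symm⟩
  · rw [card_edgeSet hl hs]
    have := Fintype.ofFinite Q.V
    have h1 : Nat.card Q.A = Nat.card {x : Q.V // x ≠ σ} := by
      refine Nat.card_congr (Equiv.ofBijective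
        (fun a => ⟨Q.t a, fun h => ((hsink σ).2 rfl) a h⟩) ⟨?_, ?_⟩)
      · intro a b hab
        exact hinj (congrArg Subtype.val hab)
      · rintro ⟨x, hx⟩
        by_contra hcon
        exact hx ((hsink x).1 fun a ha => hcon ⟨a, Subtype.ext ha⟩)
    rw [h1, Nat.card_eq_fintype_card, Nat.card_eq_fintype_card, Fintype.card_subtype_compl,
      Fintype.card_subtype_eq]
    have : 0 < Fintype.card Q.V := Fintype.card_pos_iff.2 ⟨σ⟩
    omega

end FinQuiver

/-- A rooted tree quiver `(Q, σ)`. -/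
structure RootedTreeQuiver : Type (u + 1) extends FinQuiver.{u} where
  root : V
  isRootedTree : toFinQuiver.IsRootedTree root

/-! ### Joining rooted trees at a new root -/

/-- The quiver obtained from a family of rooted trees `T i` by adding a new vertex `none` and, for
every `i`, an arrow from the root of `T i` to the new vertex.  In other words, each `T i` is
extended by one arrow at its root, and the results are glued at their sinks. -/
def joinQuiver {ι : Type u} [Finite ι] (T : ι → RootedTreeQuiver.{u}) : FinQuiver.{u} where
  V := Option (Σ i, (T i).V)
  A := (Σ i, (T i).A) ⊕ ι
  t := Sum.elim (fun b => some ⟨b.1, (T b.1).t b.2⟩) (fun i => some ⟨i, (T i).root⟩)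
  h := Sum.elim (fun b => some ⟨b.1, (T b.1).h b.2⟩) (fun _ => none)

lemma joinQuiver_isRootedTree {ι : Type u} [Finite ι] (T : ι → RootedTreeQuiver.{u}) :
    (joinQuiver T).IsRootedTree none := by
  have hroot : ∀ i (b : (T i).A), (T i).t b ≠ (T i).root := fun i =>
    ((T i).isRootedTree.sink _).2 rfl
  refine FinQuiver.isRootedTree_of ?_ ?_ ?_ ?_
  · rintro (⟨i, a⟩ | i) (⟨j, b⟩ | j) hab
    · simp only [joinQuiver, Sum.elim_inl, Option.some.injEq, Sigma.mk.injEq] at hab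
      obtain ⟨rfl, hab⟩ := hab
      rw [(T i).isRootedTree.t_injective (eq_of_heq hab)]
    · simp only [joinQuiver, Sum.elim_inl, Sum.elim_inr, Option.some.injEq,
        Sigma.mk.injEq] at hab
      obtain ⟨rfl, hab⟩ := hab
      exact (hroot i a (eq_of_heq hab)).elim
    · simp only [joinQuiver, Sum.elim_inl, Sum.elim_inr, Option.some.injEq,
        Sigma.mk.injEq] at hab
      obtain ⟨rfl, hab⟩ := hab
      exact (hroot i b (eq_of_heq hab).symm).elim
    · simp only [joinQuiver, Sum.elim_inr, Option.some.injEq, Sigma.mk.injEq] at hab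
      rw [hab.1]
  · intro x
    constructor
    · intro hx
      rcases x with _ | ⟨i, x⟩
      · rfl
      · have hx' : x = (T i).root := ((T i).isRootedTree.sink x).1 fun a ha =>
          hx (Sum.inl ⟨i, a⟩) (by subst ha; rfl)
        exact (hx (Sum.inr i) (by rw [hx']; rfl)).elim
    · rintro rfl (a | i) h <;> exact Option.some_ne_none _ h
  · have hacc : ∀ i (x : (T i).V), Acc (joinQuiver T).Child (some ⟨i, x⟩) := by
      intro i x
      induction x using (T i).isRootedTree.wf.induction with
      | _ x ih =>
        refine Acc.intro _ ?_
        rintro y ⟨(⟨j, b⟩ | j), rfl, hb⟩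
        · simp only [joinQuiver, Sum.elim_inl, Option.some.injEq, Sigma.mk.injEq] at hb
          obtain ⟨rfl, hb⟩ := hb
          exact ih _ ⟨b, rfl, eq_of_heq hb⟩
        · exact (Option.some_ne_none _ hb.symm).elim
    refine ⟨fun x => ?_⟩
    rcases x with _ | ⟨i, x⟩
    · refine Acc.intro _ ?_
      rintro y ⟨(b | j), rfl, hb⟩
      · exact hacc _ _
      · exact hacc _ _
    · exact hacc i x
  · intro x
    rcases x with _ | ⟨i, x⟩
    · exact SimpleGraph.Reachable.refl _
    · let φ : (T i).underlying →g (joinQuiver T).underlying :=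
        { toFun := fun y => some ⟨i, y⟩
          map_rel' := by
            intro y z hyz
            rw [FinQuiver.underlying_adj] at hyz
            refine FinQuiver.underlying_adj.2 ⟨fun h => hyz.1 ?_, ?_⟩
            · simpa using Option.some_injective _ h
            · rcases hyz.2 with ⟨a, rfl, rfl⟩ | ⟨a, rfl, rfl⟩
              · exact Or.inl ⟨Sum.inl ⟨i, a⟩, rfl, rfl⟩
              · exact Or.inr ⟨Sum.inl ⟨i, a⟩, rfl, rfl⟩ }
      have h1 := ((T i).isRootedTree.isTree.connected.preconnected x (T i).root).map φ
      refine h1.trans (SimpleGraph.Adj.reachable ?_)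
      exact FinQuiver.underlying_adj.2 ⟨Option.some_ne_none _, Or.inl ⟨Sum.inr i, rfl, rfl⟩⟩

/-- `joinQuiver` as a rooted tree quiver. -/
def join {ι : Type u} [Finite ι] (T : ι → RootedTreeQuiver.{u}) : RootedTreeQuiver.{u} where
  toFinQuiver := joinQuiver T
  root := none
  isRootedTree := joinQuiver_isRootedTree T

/-- A rooted tree quiver over `Q` whose root lies over the vertex `x`. -/
structure TreeOver (Q : FinQuiver.{u}) (x : Q.V) : Type (u + 1) where
  src : RootedTreeQuiver.{u}
  str : QHom src.toFinQuiver Q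
  str_root : str.onV src.root = x

/-- The arrows of `Q` with head `x`. -/
abbrev FinQuiver.In (Q : FinQuiver.{u}) (x : Q.V) : Type u := {a : Q.A // Q.h a = x}

/-- Given a family of arrows `arr i` of `Q` with head `x`, and rooted trees `T i` over `Q` with
root over the tail of `arr i`, the tree over `Q` obtained by joining the `T i` at a new root over
`x`, the new arrows lying over the `arr i`. -/
def TreeOver.join {Q : FinQuiver.{u}} (x : Q.V) {ι : Type u} [Finite ι] (arr : ι → Q.In x)
    (T : ∀ i, TreeOver Q (Q.t (arr i).1)) : TreeOver Q x where
  src := RootedTreeReps.join fun i => (T i).src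
  str :=
    { onV := fun y => Option.elim y x fun y => (T y.1).str.onV y.2
      onA := Sum.elim (fun b => (T b.1).str.onA b.2) (fun i => (arr i).1)
      map_t := by
        rintro (b | i)
        · exact (T b.1).str.map_t b.2
        · exact (T i).str_root.symm
      map_h := by
        rintro (b | i)
        · exact (T b.1).str.map_h b.2
        · exact (arr i).2 }
  str_root := rfl

/-! ### The lattices `L_Q(x)` and the reduced quivers over `Q` -/

/-- A finite lattice. -/
structure FinLattice : Type (u + 1) where
  carrier : Type u
  [lattice : Lattice carrier]
  [finite : Finite carrier]

instance : CoeSort FinLattice.{u} (Type u) := ⟨FinLattice.carrier⟩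

attribute [instance] FinLattice.lattice FinLattice.finite

instance {α : Type u} [LE α] [Finite α] : Finite (LowerSet α) :=
  Finite.of_injective (fun s : LowerSet α => (s : Set α)) SetLike.coe_injective

/-- The recursion `L_Q(x) = ∏_a J(L_Q(t a))`, over all arrows `a` with head `x`, where `J` denotes
the lattice of order ideals (lower sets, including the empty one) ordered by inclusion. -/
noncomputable def latticeRec {Q : FinQuiver.{u}} {x : Q.V} (hx : Acc Q.Child x) : FinLattice.{u} :=
  Acc.rec (motive := fun _ _ => FinLattice.{u})
    (fun x _ ih =>
      { carrier := ∀ a : Q.In x, LowerSet (ih (Q.t a.1) ⟨a.1, rfl, a.2⟩) }) hx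

/-- The reduced quiver `Q_M → Q`.  Its root lies over `x`, and for every arrow `a` with head `x`
and every maximal element `S` of the ideal `M a`, a copy of the reduced quiver `Q_S` is attached to
the root by an arrow lying over `a`. -/
noncomputable def reducedRec {Q : FinQuiver.{u}} {x : Q.V} (hx : Acc Q.Child x) :
    latticeRec hx → TreeOver Q x :=
  Acc.rec (motive := fun x hx => latticeRec hx → TreeOver Q x)
    (fun x hx ih (M : ∀ a : Q.In x, LowerSet (latticeRec (hx (Q.t a.1) ⟨a.1, rfl, a.2⟩))) =>
      TreeOver.join x (ι := Σ a : Q.In x, {S // Maximal (· ∈ M a) S}) (fun i => i.1)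
        (fun i => ih (Q.t i.1.1) ⟨i.1.1, rfl, i.1.2⟩ i.2.1)) hx

namespace RootedTreeQuiver

variable (Q : RootedTreeQuiver.{u})

/-- The lattice `L_Q(x)`. -/
noncomputable def L (x : Q.V) : FinLattice.{u} := latticeRec (Q.isRootedTree.wf.apply x)

/-- The reduced quiver over `Q` associated with `M ∈ L_Q(x)`, with its structure map. -/
noncomputable def reduced {x : Q.V} (M : Q.L x) : TreeOver Q.toFinQuiver x :=
  reducedRec (Q.isRootedTree.wf.apply x) M

end RootedTreeQuiver

/-- The rooted tree quiver `Q_M`. -/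
noncomputable def redQuiver {Q : RootedTreeQuiver.{u}} {x : Q.V} (M : Q.L x) : RootedTreeQuiver.{u} :=
  (Q.reduced M).src

/-- The structure map `c_M : Q_M → Q`. -/
noncomputable def redMap {Q : RootedTreeQuiver.{u}} {x : Q.V} (M : Q.L x) :
    QHom (redQuiver M).toFinQuiver Q.toFinQuiver :=
  (Q.reduced M).str

/-- The pair `(π_*, π^*)` is the lattice adjunction between `L_{Q_M}(σ_M)` and `L_Q(x)` associated
with `M`: for every `A`, `π_* A` is the unique `N` such that the composition
`(Q_M)_A → Q_M → Q` is rank equivalent to `Q_N`, and `π^*` is the upper adjoint of `π_*`. -/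
structure IsAdjunctionOf {Q : RootedTreeQuiver.{u}} {x : Q.V} (M : Q.L x)
    (push : (redQuiver M).L (redQuiver M).root → Q.L x)
    (pull : Q.L x → (redQuiver M).L (redQuiver M).root) : Prop where
  rankEquiv_iff : ∀ A N, RankEquiv ((redMap A).comp (redMap M)) (redMap N) ↔ N = push A
  adjunction : GaloisConnection push pull

/-! ### Representations -/

/-- A (finite dimensional) representation of `Q` over `K`. -/
structure QRep (K : Type v) [Field K] (Q : FinQuiver.{u}) where
  obj : Q.V → Type w
  [addCommGroup : ∀ x, AddCommGroup (obj x)]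
  [module : ∀ x, Module K (obj x)]
  [finiteDimensional : ∀ x, FiniteDimensional K (obj x)]
  map : ∀ a, obj (Q.t a) →ₗ[K] obj (Q.h a)

attribute [instance] QRep.addCommGroup QRep.module QRep.finiteDimensional

namespace QRep

variable {K : Type v} [Field K] {Q Q' : FinQuiver.{u}}

/-- Isomorphism of representations. -/
def IsIso (V : QRep.{u, v, w} K Q) (W : QRep.{u, v, w'} K Q) : Prop :=
  ∃ e : ∀ x, V.obj x ≃ₗ[K] W.obj x,
    ∀ a (m : V.obj (Q.t a)), e (Q.h a) (V.map a m) = W.map a (e (Q.t a) m)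

/-- The support of a representation. -/
def supp (V : QRep.{u, v, w} K Q) : Set Q.V := {x | Nontrivial (V.obj x)}

/-- The identity representation: `K` at every vertex, the identity map at every arrow. -/
def one (K : Type v) [Field K] (Q : FinQuiver.{u}) : QRep.{u, v, v} K Q where
  obj _ := K
  map _ := LinearMap.id

/-- Direct sum of two representations. -/
def oplus (V : QRep.{u, v, w} K Q) (W : QRep.{u, v, w'} K Q) : QRep.{u, v, max w w'} K Q where
  obj x := V.obj x × W.obj x
  map a := (V.map a).prodMap (W.map a)

/-- Direct sum of a finite (possibly empty) family of representations. -/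
def sum {n : ℕ} (V : Fin n → QRep.{u, v, w} K Q) : QRep.{u, v, w} K Q where
  obj x := ∀ i, (V i).obj x
  map a := LinearMap.pi fun i => (V i).map a ∘ₗ LinearMap.proj i

/-- Pointwise tensor product of representations. -/
noncomputable def tensor (V : QRep.{u, v, w} K Q) (W : QRep.{u, v, w'} K Q) :
    QRep.{u, v, max w w'} K Q where
  obj x := V.obj x ⊗[K] W.obj x
  map a := TensorProduct.map (V.map a) (W.map a)

/-- Pullback of representations along a map of directed graphs, `(f^* W)_x = W_{f x}`.  The
recasting along `f (t a) = t (f a)` and `f (h a) = h (f a)` is the identity map. -/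
def pullback (f : QHom Q' Q) (W : QRep.{u, v, w} K Q) : QRep.{u, v, w} K Q' where
  obj x := W.obj (f.onV x)
  map a := (LinearEquiv.cast (R := K) (M := W.obj) (f.map_h a)).toLinearMap ∘ₗ
    W.map (f.onA a) ∘ₗ (LinearEquiv.cast (R := K) (M := W.obj) (f.map_t a).symm).toLinearMap

open Classical in
/-- Pushforward of representations along a map of directed graphs: the space at `x` is the direct
sum of the `V_y` with `f y = x`, and the map at `a` is the sum of the `V_b` with `f b = a`. -/
noncomputable def pushforward (f : QHom Q' Q) (V : QRep.{u, v, w} K Q') :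
    QRep.{u, v, max u w} K Q where
  obj x := ∀ y : {y : Q'.V // f.onV y = x}, V.obj y.1
  map a :=
    letI := Fintype.ofFinite {b : Q'.A // f.onA b = a}
    ∑ b : {b : Q'.A // f.onA b = a},
      LinearMap.single K (fun y : {y : Q'.V // f.onV y = Q.h a} => V.obj y.1)
          ⟨Q'.h b.1, by rw [← f.map_h, b.2]⟩ ∘ₗ
        V.map b.1 ∘ₗ
        LinearMap.proj (⟨Q'.t b.1, by rw [← f.map_t, b.2]⟩ : {y : Q'.V // f.onV y = Q.t a})

/-- The reduced representation of `Q` associated with `M ∈ L_Q(x)`: the pushforward along `c_M` of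
the identity representation of `Q_M`. -/
noncomputable def charrep (K : Type v) [Field K] {Q : RootedTreeQuiver.{u}} {x : Q.V} (M : Q.L x) :
    QRep.{u, v, max u v} K Q.toFinQuiver :=
  pushforward (redMap M) (one K (redQuiver M).toFinQuiver)

/-- `U` is isomorphic to a finite (possibly empty) direct sum of reduced representations of `Q`. -/
def IsSumOfReduced {Q : RootedTreeQuiver.{u}} (U : QRep.{u, v, w} K Q.toFinQuiver) : Prop :=
  ∃ (n : ℕ) (B : Fin n → Σ y : Q.V, Q.L y), IsIso U (sum fun i => charrep K (B i).2)

end QRep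

end RootedTreeReps

open RootedTreeReps

/-!
A tree over `Q` with root over `x` is a rooted tree quiver `T` with a quiver morphism `c : T → Q`
that sends the root to `x`; the root is then the only vertex over `x`. Trees over `Q` at `x` are
preordered by the existence of morphisms over `Q`, and the proof rests on three facts.

* `RootedTreeQuiver.le_iff_homOver`: for `M, N ∈ L_Q(x)` one has `M ≤ N` exactly when `Q_M` maps
  to `Q_N` over `Q`. Morphisms between trees are found by choosing, for every subtree at the root
  of the source, a subtree at the root of the target to which it maps; so this follows by
  recursion from the fact that an ideal of a finite poset is generated by its maximal elements.
  For the same reason `Q_M` has no endomorphisms but the identity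
  (`RootedTreeQuiver.end_reduced`), so that rank equivalence to `Q_M` only means that there are
  morphisms in both directions.
* `QRep.exists_reduced`: every tree `T` over `Q` at `x` is rank equivalent to some `Q_M`, and
  `c_* 1_T ≃ 1_M ⊕ U` with `U` a sum of reduced representations that vanish at `x`. By induction the
  subtrees `T_i` at the root of `T` have this property, with `M_i` in place of `M`. If `M_i ≤ M_j`
  for two subtrees attached over the same arrow, the morphism `Q_{M_i} → Q_{M_j}` induces a map `f`
  of representations compatible with the map to the root, and the change of basis `e ↦ e - f(e)` on
  `1_{M_i} ⊕ 1_{M_j}` detaches the summand `1_{M_i}` from the root. What remains attached are the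
  maximal ones among the `M_i`, that is, the root and the subtrees of `Q_M` (`QRep.Decomp.join`).
* The representations `c^* 1_N`, `c_* 1_A` and `1_M ⊗ 1_N` are all pushforwards of identity
  representations of trees: of the fibre product `Q_M ×_Q Q_N` over `Q_M`, of `(Q_M)_A` over `Q`,
  and of `Q_M ×_Q Q_N` over `Q`. A fibre product of trees with roots over the same vertex is again
  a tree (`TreeOver.prod`), because a vertex of `Q` has only one path to the root.

Hence `π^* N` and `π_* A` are the elements of the lattices that correspond to the first two of
these trees. The adjunction, and the identification of the third tree with `M ⊓ N`, follow from
the universal property of the fibre product.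
-/

namespace RootedTreeReps

/-! ### Paths in rooted tree quivers -/

namespace FinQuiver

variable {Q : FinQuiver.{u}} {σ : Q.V}

lemma IsRootedTree.exists_arrow (hQ : Q.IsRootedTree σ) {x : Q.V} (hx : x ≠ σ) :
    ∃ a, Q.t a = x := by
  by_contra h
  exact hx ((hQ.sink x).1 fun a ha => h ⟨a, ha⟩)

lemma IsRootedTree.t_ne_root (hQ : Q.IsRootedTree σ) (a : Q.A) : Q.t a ≠ σ :=
  (hQ.sink σ).2 rfl a

lemma IsRootedTree.reflTransGen_root (hQ : Q.IsRootedTree σ) (x : Q.V) :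
    Relation.ReflTransGen Q.Child x σ := by
  induction hn : Q.underlying.dist σ x using Nat.strong_induction_on generalizing x with
  | _ n ih =>
    by_cases hx : x = σ
    · rw [hx]
    · obtain ⟨a, rfl⟩ := hQ.exists_arrow hx
      exact .head ⟨a, rfl, rfl⟩ (ih _ (hQ.dist_lt n a hn) _ rfl)

lemma IsRootedTree.not_transGen_self (hQ : Q.IsRootedTree σ) (x : Q.V) :
    ¬ Relation.TransGen Q.Child x x := fun h =>
  hQ.wf.transGen.asymmetric x x h h

lemma IsRootedTree.rightUnique_child (hQ : Q.IsRootedTree σ) : Relator.RightUnique Q.Child := by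
  rintro x y z ⟨a, rfl, rfl⟩ ⟨b, hb, rfl⟩
  rw [hQ.t_injective hb]

/-- In `isRootedTree_of` the reachability of the sink is automatic, since the quiver is finite. -/
lemma isRootedTree_of_wf (hinj : Function.Injective Q.t)
    (hsink : ∀ x, (∀ a, Q.t a ≠ x) ↔ x = σ) (hwf : WellFounded Q.Child) :
    Q.IsRootedTree σ := by
  refine isRootedTree_of hinj hsink hwf fun x => ?_
  have : Std.Irrefl (Function.swap (Relation.TransGen Q.Child)) :=
    ⟨fun x h => hwf.transGen.asymmetric x x h h⟩
  have : IsTrans Q.V (Function.swap (Relation.TransGen Q.Child)) :=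
    ⟨fun _ _ _ h h' => h'.trans h⟩
  have hwf' := Finite.wellFounded_of_trans_of_irrefl (Function.swap (Relation.TransGen Q.Child))
  induction x using hwf'.induction with
  | _ x ih =>
    by_cases hx : x = σ
    · rw [hx]
    · by_cases h : ∃ a, Q.t a = x
      · obtain ⟨a, rfl⟩ := h
        have hc : Q.Child (Q.t a) (Q.h a) := ⟨a, rfl, rfl⟩
        refine SimpleGraph.Reachable.trans (SimpleGraph.Adj.reachable ?_)
          (ih _ (Relation.TransGen.single hc))
        refine underlying_adj.2 ⟨fun h => ?_, Or.inl hc⟩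
        rw [← h] at hc
        exact hwf.asymmetric _ _ hc hc
      · exact (hx ((hsink x).1 fun a ha => h ⟨a, ha⟩)).elim

end FinQuiver

namespace QHom

variable {Q₁ Q₂ Q₃ : FinQuiver.{u}}

lemma child (f : QHom Q₁ Q₂) {x y : Q₁.V} (h : Q₁.Child x y) :
    Q₂.Child (f.onV x) (f.onV y) := by
  obtain ⟨a, rfl, rfl⟩ := h
  exact ⟨f.onA a, f.map_t a, f.map_h a⟩

lemma transGen (f : QHom Q₁ Q₂) {x y : Q₁.V} (h : Relation.TransGen Q₁.Child x y) :
    Relation.TransGen Q₂.Child (f.onV x) (f.onV y) :=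
  Relation.TransGen.lift f.onV (fun _ _ => f.child) _ _ h

lemma reflTransGen (f : QHom Q₁ Q₂) {x y : Q₁.V} (h : Relation.ReflTransGen Q₁.Child x y) :
    Relation.ReflTransGen Q₂.Child (f.onV x) (f.onV y) :=
  Relation.ReflTransGen.lift f.onV (fun _ _ => f.child) _ _ h

lemma onV_of_comp_eq {f : QHom Q₁ Q₂} {g : QHom Q₂ Q₃} {k : QHom Q₁ Q₃} (h : f.comp g = k)
    (x : Q₁.V) : g.onV (f.onV x) = k.onV x := congrArg (fun q => q.onV x) h

lemma onA_of_comp_eq {f : QHom Q₁ Q₂} {g : QHom Q₂ Q₃} {k : QHom Q₁ Q₃} (h : f.comp g = k)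
    (a : Q₁.A) : g.onA (f.onA a) = k.onA a := congrArg (fun q => q.onA a) h

end QHom

/-- There is a morphism over `Q` from `c : Λ → Q` to `d : Γ → Q`. -/
def HomOver {Q Λ Γ : FinQuiver.{u}} (c : QHom Λ Q) (d : QHom Γ Q) : Prop :=
  ∃ g : QHom Λ Γ, g.comp d = c

lemma HomOver.refl {Q Λ : FinQuiver.{u}} (c : QHom Λ Q) : HomOver c c := ⟨QHom.id Λ, rfl⟩

lemma HomOver.trans {Q Λ Γ Δ : FinQuiver.{u}} {c : QHom Λ Q} {d : QHom Γ Q} {e : QHom Δ Q}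
    (h : HomOver c d) (h' : HomOver d e) : HomOver c e := by
  obtain ⟨g, rfl⟩ := h
  obtain ⟨k, rfl⟩ := h'
  exact ⟨g.comp k, rfl⟩

/-- The root is the only vertex of a tree over `Q` that lies over the same vertex as the root:
every other vertex has a nonempty path to the root, and `Q` has no cycles. -/
lemma TreeOver.eq_root {Q : RootedTreeQuiver.{u}} {x : Q.V} (T : TreeOver Q.toFinQuiver x)
    {z : T.src.V} (hz : T.str.onV z = x) : z = T.src.root := by
  rcases Relation.reflTransGen_iff_eq_or_transGen.1
    (T.src.isRootedTree.reflTransGen_root z) with h | h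
  · exact h.symm
  · have := T.str.transGen h
    rw [hz, T.str_root] at this
    exact (Q.isRootedTree.not_transGen_self x this).elim

/-! ### Morphisms out of a join -/

section Join

variable {ι : Type u} [Finite ι] (T : ι → RootedTreeQuiver.{u})

/-- The inclusion of one of the joined trees. -/
def joinIncl (i : ι) : QHom (T i).toFinQuiver (joinQuiver T) where
  onV z := some ⟨i, z⟩
  onA b := Sum.inl ⟨i, b⟩
  map_t _ := rfl
  map_h _ := rfl

variable {T}

/-- A morphism out of a join, given by its restrictions `g i` to the joined trees, the image `y`
of the new root and the images `b i` of the new arrows. -/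
def joinLift {Λ : FinQuiver.{u}} (g : ∀ i, QHom (T i).toFinQuiver Λ) (y : Λ.V) (b : ι → Λ.A)
    (ht : ∀ i, Λ.t (b i) = (g i).onV (T i).root) (hh : ∀ i, Λ.h (b i) = y) :
    QHom (joinQuiver T) Λ where
  onV z := Option.elim z y fun z => (g z.1).onV z.2
  onA := Sum.elim (fun c => (g c.1).onA c.2) b
  map_t := by
    rintro (c | i)
    · exact (g c.1).map_t c.2
    · exact ht i
  map_h := by
    rintro (c | i)
    · exact (g c.1).map_h c.2
    · exact hh i

end Join

lemma QHom.ext_join {ι : Type u} [Finite ι] {T : ι → RootedTreeQuiver.{u}} {Λ : FinQuiver.{u}}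
    {f g : QHom (joinQuiver T) Λ} (h : ∀ i, (joinIncl T i).comp f = (joinIncl T i).comp g)
    (h0 : f.onV none = g.onV none) (h1 : ∀ i, f.onA (Sum.inr i) = g.onA (Sum.inr i)) : f = g := by
  refine QHom.ext (funext ?_) (funext ?_)
  · rintro (_ | ⟨i, z⟩)
    · exact h0
    · exact congrArg (fun q => q.onV z) (h i)
  · rintro (⟨i, c⟩ | i)
    · exact congrArg (fun q => q.onA c) (h i)
    · exact h1 i

section JoinOver

variable {Q : RootedTreeQuiver.{u}} {x : Q.V} {ι κ : Type u} [Finite ι] [Finite κ]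
  {arr : ι → Q.In x} {T : ∀ i, TreeOver Q.toFinQuiver (Q.t (arr i).1)}
  {arr' : κ → Q.In x} {T' : ∀ j, TreeOver Q.toFinQuiver (Q.t (arr' j).1)}

lemma homOver_join (h : ∀ i, ∃ j, arr' j = arr i ∧ HomOver (T i).str (T' j).str) :
    HomOver (TreeOver.join x arr T).str (TreeOver.join x arr' T').str := by
  choose f hf g hg using h
  refine ⟨joinLift (fun i => (g i).comp (joinIncl (fun j => (T' j).src) (f i))) none
    (fun i => Sum.inr (f i)) (fun i => ?_) (fun i => rfl), ?_⟩
  · have : (g i).onV (T i).src.root = (T' (f i)).src.root := by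
      refine (T' (f i)).eq_root ?_
      rw [QHom.onV_of_comp_eq (hg i), (T i).str_root, hf]
    change some _ = some _
    rw [this]
  · refine QHom.ext_join (fun i => ?_) rfl (fun i => ?_)
    · exact hg i
    · exact congrArg Subtype.val (hf i)

/-- A morphism of joins over `Q` sends the new arrow at `T i` to the new arrow at some `T' j` and
restricts to a morphism from `T i` to `T' j`. -/
lemma exists_restrict (g : QHom (joinQuiver fun i => (T i).src) (joinQuiver fun j => (T' j).src))
    (hg : g.comp (TreeOver.join x arr' T').str = (TreeOver.join x arr T).str) (i : ι) :
    ∃ j, arr' j = arr i ∧ g.onA (Sum.inr i) = Sum.inr j ∧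
      ∃ k : QHom (T i).src.toFinQuiver (T' j).src.toFinQuiver, k.comp (T' j).str = (T i).str ∧
        (joinIncl (fun i => (T i).src) i).comp g =
          k.comp (joinIncl (fun j => (T' j).src) j) := by
  have hroot : g.onV none = none :=
    (TreeOver.join x arr' T').eq_root (QHom.onV_of_comp_eq hg none)
  obtain ⟨j, hj⟩ : ∃ j, g.onA (Sum.inr i) = Sum.inr j := by
    have h1 := g.map_h (Sum.inr i)
    rcases h2 : g.onA (Sum.inr i) with b | j
    · rw [h2] at h1
      exact (Option.some_ne_none _ (h1.trans hroot)).elim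
    · exact ⟨j, rfl⟩
  have hV : ∀ z : (T i).src.V, ∃ w : (T' j).src.V, g.onV (some ⟨i, z⟩) = some ⟨j, w⟩ := by
    intro z
    induction (T i).src.isRootedTree.reflTransGen_root z
      using Relation.ReflTransGen.head_induction_on with
    | refl =>
      have h1 := g.map_t (Sum.inr i)
      rw [hj] at h1
      exact ⟨_, h1.symm⟩
    | head hc _ ih =>
      obtain ⟨b, rfl, rfl⟩ := hc
      obtain ⟨w, hw⟩ := ih
      have h1 := g.map_h (Sum.inl ⟨i, b⟩)
      have h2 := g.map_t (Sum.inl ⟨i, b⟩)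
      rcases h3 : g.onA (Sum.inl ⟨i, b⟩) with ⟨j', c⟩ | j'
      · rw [h3] at h1 h2
        have h4 := h1.trans hw
        simp only [joinQuiver, Sum.elim_inl, Option.some.injEq, Sigma.mk.injEq] at h4
        obtain ⟨rfl, -⟩ := h4
        exact ⟨_, h2.symm⟩
      · rw [h3] at h1
        exact (Option.some_ne_none _ (h1.trans hw).symm).elim
  choose kV hkV using hV
  have hA : ∀ b : (T i).src.A, ∃ c : (T' j).src.A, g.onA (Sum.inl ⟨i, b⟩) = Sum.inl ⟨j, c⟩ := by
    intro b
    have h1 := (g.map_h (Sum.inl ⟨i, b⟩)).trans (hkV _)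
    rcases h3 : g.onA (Sum.inl ⟨i, b⟩) with ⟨j', c⟩ | j'
    · rw [h3] at h1
      simp only [joinQuiver, Sum.elim_inl, Option.some.injEq, Sigma.mk.injEq] at h1
      obtain ⟨rfl, -⟩ := h1
      exact ⟨c, rfl⟩
    · rw [h3] at h1
      exact (Option.some_ne_none _ h1.symm).elim
  choose kA hkA using hA
  refine ⟨j, ?_, hj, ⟨kV, kA, fun b => ?_, fun b => ?_⟩, ?_, ?_⟩
  · have := QHom.onA_of_comp_eq hg (Sum.inr i)
    rw [hj] at this
    exact Subtype.ext this
  · have h1 := (g.map_t (Sum.inl ⟨i, b⟩)).trans (hkV _)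
    rw [hkA] at h1
    simpa [joinQuiver] using h1
  · have h1 := (g.map_h (Sum.inl ⟨i, b⟩)).trans (hkV _)
    rw [hkA] at h1
    simpa [joinQuiver] using h1
  · refine QHom.ext (funext fun z => ?_) (funext fun b => ?_)
    · have := QHom.onV_of_comp_eq hg (some ⟨i, z⟩)
      rw [hkV] at this
      exact this
    · have := QHom.onA_of_comp_eq hg (Sum.inl ⟨i, b⟩)
      rw [hkA] at this
      exact this
  · exact QHom.ext (funext hkV) (funext hkA)

end JoinOver

/-! ### Trees over `Q` as iterated joins -/

/-- A tree over `Q` that is obtained by joining trees over `Q` recursively. -/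
inductive TreeOver.JoinBuilt {Q : FinQuiver.{u}} : ∀ {x : Q.V}, TreeOver Q x → Prop
  | join {x : Q.V} {ι : Type u} [Finite ι] (arr : ι → Q.In x)
      (T : ∀ i, TreeOver Q (Q.t (arr i).1)) (hT : ∀ i, (T i).JoinBuilt) :
      (TreeOver.join x arr T).JoinBuilt

/-- The part of a tree over `Q` above a vertex `y` is an iterated join. -/
lemma exists_joinBuilt_above {Q : FinQuiver.{u}} (Λ : RootedTreeQuiver.{u})
    (c : QHom Λ.toFinQuiver Q) (y : Λ.V) :
    ∀ x, c.onV y = x → ∃ T : TreeOver Q x, T.JoinBuilt ∧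
      ∃ f : QHom T.src.toFinQuiver Λ.toFinQuiver, f.comp c = T.str ∧ f.onV T.src.root = y ∧
        Function.Injective f.onV ∧
        ∀ z, Relation.ReflTransGen Λ.Child z y → z ∈ Set.range f.onV := by
  have hΛ := Λ.isRootedTree
  induction y using hΛ.wf.induction with
  | _ y ih =>
    rintro x rfl
    choose T hT f hf hroot hinj hsurj using fun b : Λ.In y =>
      ih (Λ.t b.1) ⟨b.1, rfl, b.2⟩ (Q.t (c.onA b.1)) (c.map_t b.1).symm
    have hcyc : ∀ b : Λ.In y, ¬ Relation.ReflTransGen Λ.Child y (Λ.t b.1) := fun b hb =>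
      hΛ.not_transGen_self y (Relation.TransGen.tail' hb ⟨b.1, rfl, b.2⟩)
    have hbelow : ∀ (b : Λ.In y) z, Relation.ReflTransGen Λ.Child ((f b).onV z) (Λ.t b.1) := by
      intro b z
      have := (f b).reflTransGen ((T b).src.isRootedTree.reflTransGen_root z)
      rwa [hroot] at this
    -- distinct children of `y` have no common descendant
    have hdisj : ∀ b b' : Λ.In y, Relation.ReflTransGen Λ.Child (Λ.t b.1) (Λ.t b'.1) → b = b' := by
      intro b b' h
      rcases Relation.ReflTransGen.cases_head h with h | ⟨z, hz, h⟩
      · exact Subtype.ext (hΛ.t_injective h)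
      · rw [hΛ.rightUnique_child hz ⟨b.1, rfl, b.2⟩] at h
        exact (hcyc b' h).elim
    let arr : Λ.In y → Q.In (c.onV y) := fun b => ⟨c.onA b.1, by rw [c.map_h, b.2]⟩
    refine ⟨TreeOver.join (c.onV y) arr T, .join arr T hT,
      joinLift f y (fun b => b.1) (fun b => (hroot b).symm) (fun b => b.2), ?_, rfl, ?_, ?_⟩
    · exact QHom.ext_join hf rfl fun _ => rfl
    · rintro (_ | ⟨b, z⟩) (_ | ⟨b', z'⟩) h
      · rfl
      · change y = (f b').onV z' at h
        have h1 := hbelow b' z'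
        rw [← h] at h1
        exact (hcyc b' h1).elim
      · change (f b).onV z = y at h
        have h1 := hbelow b z
        rw [h] at h1
        exact (hcyc b h1).elim
      · change (f b).onV z = (f b').onV z' at h
        have hbb : b = b' := by
          have h1 := hbelow b z
          rw [h] at h1
          rcases Relation.ReflTransGen.total_of_right_unique hΛ.rightUnique_child h1
            (hbelow b' z') with h2 | h2
          · exact hdisj _ _ h2
          · exact (hdisj _ _ h2).symm
        subst hbb
        rw [hinj b h]
    · intro z hz
      rcases Relation.ReflTransGen.cases_tail hz with rfl | ⟨w, hw, b, rfl, hb⟩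
      · exact ⟨none, rfl⟩
      · obtain ⟨z', hz'⟩ := hsurj ⟨b, hb⟩ z hw
        exact ⟨some ⟨⟨b, hb⟩, z'⟩, hz'⟩

/-- A morphism of rooted trees that preserves the root and is bijective on vertices is bijective
on arrows, because arrows correspond to the vertices other than the root. -/
lemma QHom.bijective_onA {Λ Γ : RootedTreeQuiver.{u}} (f : QHom Λ.toFinQuiver Γ.toFinQuiver)
    (hroot : f.onV Λ.root = Γ.root) (hf : Function.Bijective f.onV) :
    Function.Bijective f.onA := by
  constructor
  · intro a b hab
    refine Λ.isRootedTree.t_injective (hf.1 ?_)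
    rw [← f.map_t, hab, f.map_t]
  · intro b
    obtain ⟨z, hz⟩ := hf.2 (Γ.t b)
    have hne : z ≠ Λ.root := by
      rintro rfl
      exact Γ.isRootedTree.t_ne_root b (hz.symm.trans hroot)
    obtain ⟨a, rfl⟩ := Λ.isRootedTree.exists_arrow hne
    exact ⟨a, Γ.isRootedTree.t_injective ((f.map_t a).trans hz)⟩

/-- Every tree over `Q` is isomorphic over `Q` to an iterated join. -/
lemma exists_joinBuilt {Q : FinQuiver.{u}} {x : Q.V} (T : TreeOver Q x) :
    ∃ T' : TreeOver Q x, T'.JoinBuilt ∧ ∃ f : QHom T'.src.toFinQuiver T.src.toFinQuiver,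
      f.comp T.str = T'.str ∧ Function.Bijective f.onV ∧ Function.Bijective f.onA := by
  obtain ⟨T', hT', f, hf, hroot, hinj, hsurj⟩ :=
    exists_joinBuilt_above T.src T.str T.src.root x T.str_root
  have hb : Function.Bijective f.onV :=
    ⟨hinj, fun z => hsurj z (T.src.isRootedTree.reflTransGen_root z)⟩
  exact ⟨T', hT', f, hf, hb, f.bijective_onA hroot hb⟩

/-- A bijective morphism over `Q` has an inverse over `Q`. -/
lemma HomOver.of_bijective {Q Λ Γ : FinQuiver.{u}} {c : QHom Λ Q} {d : QHom Γ Q} (f : QHom Λ Γ)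
    (hf : f.comp d = c) (hV : Function.Bijective f.onV) (hA : Function.Bijective f.onA) :
    HomOver d c := by
  subst hf
  let eV := Equiv.ofBijective _ hV
  let eA := Equiv.ofBijective _ hA
  have hV' : ∀ z, f.onV (eV.symm z) = z := eV.apply_symm_apply
  have hA' : ∀ z, f.onA (eA.symm z) = z := eA.apply_symm_apply
  refine ⟨⟨eV.symm, eA.symm, fun b => hV.1 ?_, fun b => hV.1 ?_⟩, ?_⟩
  · rw [← f.map_t, hA', hV']
  · rw [← f.map_h, hA', hV']
  · refine QHom.ext (funext fun z => ?_) (funext fun b => ?_)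
    · change d.onV (f.onV (eV.symm z)) = _
      rw [hV']
    · change d.onA (f.onA (eA.symm b)) = _
      rw [hA']

/-! ### The order of `L_Q(x)` in terms of morphisms of reduced quivers -/

/-- One step of the recursion defining `latticeRec`. -/
noncomputable def latticeRecEquiv {Q : FinQuiver.{u}} {x : Q.V} (hx : Acc Q.Child x) :
    latticeRec hx ≃o
      ∀ a : Q.In x, LowerSet (latticeRec (hx.inv (⟨a.1, rfl, a.2⟩ : Q.Child (Q.t a.1) x))) := by
  cases hx
  exact OrderIso.refl _

lemma reducedRec_eq {Q : FinQuiver.{u}} {x : Q.V} (hx : Acc Q.Child x) (M : latticeRec hx) :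
    reducedRec hx M =
      TreeOver.join x (ι := Σ a : Q.In x, {S // Maximal (· ∈ latticeRecEquiv hx M a) S})
        (fun i => i.1)
        (fun i => reducedRec (hx.inv (⟨i.1.1, rfl, i.1.2⟩ : Q.Child (Q.t i.1.1) x)) i.2.1) := by
  cases hx
  rfl

namespace RootedTreeQuiver

variable (Q : RootedTreeQuiver.{u})

/-- The recursive description of `L_Q(x)`: an element is a family of order ideals of the lattices
`L_Q(t a)`. -/
noncomputable def latticeEquiv (x : Q.V) : Q.L x ≃o ∀ a : Q.In x, LowerSet (Q.L (Q.t a.1)) :=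
  latticeRecEquiv (Q.isRootedTree.wf.apply x)

variable {Q}

/-- The index set of the subtrees of `Q_M` at its root: the maximal elements of the ideals of
`M`. -/
abbrev MaxIndex {x : Q.V} (M : Q.L x) : Type u :=
  Σ a : Q.In x, {S // Maximal (· ∈ Q.latticeEquiv x M a) S}

lemma reduced_eq {x : Q.V} (M : Q.L x) :
    Q.reduced M = TreeOver.join x (ι := MaxIndex M) (fun i => i.1) (fun i => Q.reduced i.2.1) :=
  reducedRec_eq _ M

lemma le_iff_exists_maximal {x : Q.V} (M N : Q.L x) :
    M ≤ N ↔ ∀ a S, Maximal (· ∈ Q.latticeEquiv x M a) S →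
      ∃ S', Maximal (· ∈ Q.latticeEquiv x N a) S' ∧ S ≤ S' := by
  rw [← (Q.latticeEquiv x).le_iff_le]
  constructor
  · rintro h a S hS
    obtain ⟨S', hle, hS'⟩ := (Set.toFinite {S | S ∈ Q.latticeEquiv x N a}).exists_le_maximal
      (h a hS.prop)
    exact ⟨S', hS', hle⟩
  · intro h a S hS
    obtain ⟨S', hle, hS'⟩ := (Set.toFinite {S | S ∈ Q.latticeEquiv x M a}).exists_le_maximal hS
    obtain ⟨S'', hS'', h'⟩ := h a S' hS'
    exact (Q.latticeEquiv x N a).lower (hle.trans h') hS''.prop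

/-- In `L_Q(x)`, the relation `M ≤ N` means that `Q_M` maps to `Q_N` over `Q`. -/
theorem le_iff_homOver {x : Q.V} (M N : Q.L x) :
    M ≤ N ↔ HomOver (Q.reduced M).str (Q.reduced N).str := by
  induction x using Q.isRootedTree.wf.induction with
  | _ x ih =>
    rw [le_iff_exists_maximal, reduced_eq M, reduced_eq N]
    constructor
    · intro h
      refine homOver_join fun i => ?_
      obtain ⟨S', hS', hle⟩ := h i.1 i.2.1 i.2.2
      exact ⟨⟨i.1, S', hS'⟩, rfl, (ih _ ⟨i.1.1, rfl, i.1.2⟩ _ _).1 hle⟩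
    · rintro ⟨g, hg⟩ a S hS
      obtain ⟨⟨b, S', hS'⟩, hj, -, k, hk, -⟩ := exists_restrict g hg ⟨a, S, hS⟩
      obtain rfl : b = a := hj
      exact ⟨S', hS', (ih _ ⟨b.1, rfl, b.2⟩ _ _).2 ⟨k, hk⟩⟩

/-- A reduced quiver has no endomorphism over `Q` other than the identity: the trees attached to
its root are pairwise incomparable, so an endomorphism maps each of them to itself. -/
theorem end_reduced {x : Q.V} (M : Q.L x)
    (g : QHom (Q.reduced M).src.toFinQuiver (Q.reduced M).src.toFinQuiver)
    (hg : g.comp (Q.reduced M).str = (Q.reduced M).str) : g = QHom.id _ := by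
  induction x using Q.isRootedTree.wf.induction with
  | _ x ih =>
    revert g
    rw [reduced_eq M]
    intro g hg
    have key : ∀ i : MaxIndex M, g.onA (Sum.inr i) = Sum.inr i ∧
        (joinIncl (fun i : MaxIndex M => (Q.reduced i.2.1).src) i).comp g =
          joinIncl (fun i : MaxIndex M => (Q.reduced i.2.1).src) i := by
      intro i
      obtain ⟨j, hj, hji, k, hk, hres⟩ := exists_restrict g hg i
      have hij : j = i := by
        obtain ⟨a, S, hS⟩ := i
        obtain ⟨b, S', hS'⟩ := j
        obtain rfl : b = a := hj
        have hle : S ≤ S' := (le_iff_homOver S S').2 ⟨k, hk⟩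
        have : S' = S := le_antisymm (hS.le_of_ge hS'.prop hle) hle
        subst this
        rfl
      subst hij
      refine ⟨hji, hres.trans ?_⟩
      rw [ih _ ⟨j.1.1, rfl, j.1.2⟩ j.2.1 k hk]
      rfl
    refine QHom.ext_join (fun i => (key i).2)
      ((TreeOver.join x (fun i : MaxIndex M => i.1) fun i => Q.reduced i.2.1).eq_root
        (QHom.onV_of_comp_eq hg none)) (fun i => (key i).1)

/-- A tree over `Q` is rank equivalent to `Q_N` as soon as there are morphisms in both
directions. -/
lemma rankEquiv_iff_homOver {x : Q.V} (N : Q.L x) {Λ : FinQuiver.{u}}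
    (c : QHom Λ Q.toFinQuiver) :
    RankEquiv c (Q.reduced N).str ↔
      HomOver (Q.reduced N).str c ∧ HomOver c (Q.reduced N).str := by
  constructor
  · rintro ⟨g, k, hg, hk, -⟩
    exact ⟨⟨g, hg⟩, ⟨k, hk⟩⟩
  · rintro ⟨⟨g, hg⟩, ⟨k, hk⟩⟩
    refine ⟨g, k, hg, hk, end_reduced N _ ?_⟩
    change g.comp (k.comp _) = _
    rw [hk, hg]

end RootedTreeQuiver

/-! ### Fibre products of trees -/

/-- The fibre product of quivers over `Q`. -/
def fibreProduct {Q Λ Γ : FinQuiver.{u}} (c : QHom Λ Q) (d : QHom Γ Q) : FinQuiver.{u} where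
  V := {p : Λ.V × Γ.V // c.onV p.1 = d.onV p.2}
  A := {p : Λ.A × Γ.A // c.onA p.1 = d.onA p.2}
  t b := ⟨(Λ.t b.1.1, Γ.t b.1.2), by rw [← c.map_t, ← d.map_t, b.2]⟩
  h b := ⟨(Λ.h b.1.1, Γ.h b.1.2), by rw [← c.map_h, ← d.map_h, b.2]⟩

section FibreProduct

variable {Q Λ Γ : FinQuiver.{u}} (c : QHom Λ Q) (d : QHom Γ Q)

/-- The first projection of the fibre product. -/
def fibreFst : QHom (fibreProduct c d) Λ :=
  ⟨fun p => p.1.1, fun b => b.1.1, fun _ => rfl, fun _ => rfl⟩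

/-- The second projection of the fibre product. -/
def fibreSnd : QHom (fibreProduct c d) Γ :=
  ⟨fun p => p.1.2, fun b => b.1.2, fun _ => rfl, fun _ => rfl⟩

lemma fibreFst_comp : (fibreFst c d).comp c = (fibreSnd c d).comp d :=
  QHom.ext (funext fun p => p.2) (funext fun b => b.2)

variable {c d}

lemma homOver_fibreFst_iff {Δ : FinQuiver.{u}} (e : QHom Δ Λ) :
    HomOver e (fibreFst c d) ↔ HomOver (e.comp c) d := by
  constructor
  · rintro ⟨g, rfl⟩
    refine ⟨g.comp (fibreSnd c d), ?_⟩
    change g.comp ((fibreSnd c d).comp d) = g.comp ((fibreFst c d).comp c)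
    rw [fibreFst_comp]
  · rintro ⟨g, hg⟩
    exact ⟨⟨fun z => ⟨(e.onV z, g.onV z), (QHom.onV_of_comp_eq hg z).symm⟩,
      fun b => ⟨(e.onA b, g.onA b), (QHom.onA_of_comp_eq hg b).symm⟩,
      fun b => Subtype.ext (Prod.ext (e.map_t b) (g.map_t b)),
      fun b => Subtype.ext (Prod.ext (e.map_h b) (g.map_h b))⟩, rfl⟩

end FibreProduct

/-- The fibre product of two trees over `Q` with roots over the same vertex is again a tree: a
pair of vertices over the same vertex `y` has a unique path to the pair of roots, the one lying
over the path from `y`. It is regarded as a tree over the first factor. -/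
def TreeOver.prod {Q : RootedTreeQuiver.{u}} {x : Q.V} (S T : TreeOver Q.toFinQuiver x) :
    TreeOver S.src.toFinQuiver S.src.root where
  src :=
    { toFinQuiver := fibreProduct S.str T.str
      root := ⟨(S.src.root, T.src.root), S.str_root.trans T.str_root.symm⟩
      isRootedTree := by
        refine FinQuiver.isRootedTree_of_wf ?_ ?_ ?_
        · intro b b' h
          have h' := congrArg Subtype.val h
          exact Subtype.ext (Prod.ext (S.src.isRootedTree.t_injective (congrArg Prod.fst h'))
            (T.src.isRootedTree.t_injective (congrArg Prod.snd h')))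
        · rintro ⟨⟨y, z⟩, hyz⟩
          change S.str.onV y = T.str.onV z at hyz
          constructor
          · intro h
            by_cases hy : y = S.src.root
            · subst hy
              obtain rfl := T.eq_root (hyz.symm.trans S.str_root)
              rfl
            · by_cases hz : z = T.src.root
              · subst hz
                exact (hy (S.eq_root (hyz.trans T.str_root))).elim
              · obtain ⟨b, rfl⟩ := S.src.isRootedTree.exists_arrow hy
                obtain ⟨b', rfl⟩ := T.src.isRootedTree.exists_arrow hz
                rw [← S.str.map_t, ← T.str.map_t] at hyz
                exact (h ⟨(b, b'), Q.isRootedTree.t_injective hyz⟩ rfl).elim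
          · intro h b hb
            have h' := congrArg (fun p => p.1.1) (hb.trans h)
            exact S.src.isRootedTree.t_ne_root _ h'
        · exact Subrelation.wf (fun h => (fibreFst S.str T.str).child h)
            (InvImage.wf (fibreFst S.str T.str).onV S.src.isRootedTree.wf) }
  str := fibreFst S.str T.str
  str_root := rfl

/-- A tree over a tree `T` over `Q` is a tree over `Q`. -/
def TreeOver.comp {Q : FinQuiver.{u}} {x : Q.V} (T : TreeOver Q x)
    (S : TreeOver T.src.toFinQuiver T.src.root) : TreeOver Q x where
  src := S.src
  str := S.str.comp T.str
  str_root := by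
    change T.str.onV (S.str.onV S.src.root) = x
    rw [S.str_root, T.str_root]

namespace QRep

/-! ### Isomorphisms and direct sums of representations -/

section Iso

universe w₁ w₂ w₃ w₄

variable {K : Type v} [Field K] {Q : FinQuiver.{u}}

lemma IsIso.symm {V : QRep.{u, v, w₁} K Q} {W : QRep.{u, v, w₂} K Q} (h : IsIso V W) :
    IsIso W V := by
  obtain ⟨e, he⟩ := h
  refine ⟨fun x => (e x).symm, fun a m => (e _).injective ?_⟩
  rw [he, LinearEquiv.apply_symm_apply, LinearEquiv.apply_symm_apply]

lemma IsIso.trans {V : QRep.{u, v, w₁} K Q} {W : QRep.{u, v, w₂} K Q} {X : QRep.{u, v, w₃} K Q}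
    (h : IsIso V W) (h' : IsIso W X) : IsIso V X := by
  obtain ⟨e, he⟩ := h
  obtain ⟨f, hf⟩ := h'
  refine ⟨fun x => (e x).trans (f x), fun a m => ?_⟩
  simp only [LinearEquiv.trans_apply, he, hf]

lemma IsIso.oplus {V : QRep.{u, v, w₁} K Q} {V' : QRep.{u, v, w₂} K Q} {W : QRep.{u, v, w₃} K Q}
    {W' : QRep.{u, v, w₄} K Q} (h : IsIso V V') (h' : IsIso W W') :
    IsIso (V.oplus W) (V'.oplus W') := by
  obtain ⟨e, he⟩ := h
  obtain ⟨f, hf⟩ := h'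
  exact ⟨fun x => (e x).prodCongr (f x), fun a m => Prod.ext (he a m.1) (hf a m.2)⟩

/-- The direct sum of a finite family of representations, over an arbitrary index type. -/
def directSum {κ : Type w₁} [Finite κ] (V : κ → QRep.{u, v, w₂} K Q) :
    QRep.{u, v, max w₁ w₂} K Q where
  obj x := ∀ i, (V i).obj x
  map a := LinearMap.pi fun i => (V i).map a ∘ₗ LinearMap.proj i

end Iso

section SumOfReduced

universe w₁ w₂ w₃ w₄

variable {K : Type v} [Field K] {Q : RootedTreeQuiver.{u}}

lemma IsSumOfReduced.of_directSum {κ : Type w₁} [Finite κ] (B : κ → Σ y : Q.V, Q.L y)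
    {U : QRep.{u, v, w} K Q.toFinQuiver}
    (h : IsIso U (directSum fun i => charrep K (B i).2)) : U.IsSumOfReduced := by
  obtain ⟨n, ⟨e⟩⟩ := Finite.exists_equiv_fin κ
  refine ⟨n, fun i => B (e.symm i), h.trans ⟨fun x =>
    LinearEquiv.piCongrLeft' K (fun i => (charrep K (B i).2).obj x) e, fun a m => rfl⟩⟩

lemma IsSumOfReduced.charrep {y : Q.V} (M : Q.L y) : (charrep K M).IsSumOfReduced := by
  refine IsSumOfReduced.of_directSum (κ := Unit) (fun _ => ⟨y, M⟩)
    ⟨fun x => (LinearEquiv.funUnique Unit K _).symm, fun a m => rfl⟩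

lemma IsSumOfReduced.oplus {U : QRep.{u, v, w₁} K Q.toFinQuiver}
    {W : QRep.{u, v, w₂} K Q.toFinQuiver} (hU : U.IsSumOfReduced) (hW : W.IsSumOfReduced) :
    (U.oplus W).IsSumOfReduced := by
  obtain ⟨n, B, h⟩ := hU
  obtain ⟨m, B', h'⟩ := hW
  refine IsSumOfReduced.of_directSum (κ := Fin n ⊕ Fin m) (Sum.elim B B')
    ((h.oplus h').trans (IsIso.symm ⟨fun x => LinearEquiv.sumPiEquivProdPi K _ _ fun i =>
      (QRep.charrep K (Sum.elim B B' i).2).obj x, fun a m => rfl⟩))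

lemma IsSumOfReduced.directSum {κ : Type w₁} [Finite κ] {V : κ → QRep.{u, v, w₂} K Q.toFinQuiver}
    (hV : ∀ i, (V i).IsSumOfReduced) : (directSum V).IsSumOfReduced := by
  choose n B e he using hV
  refine IsSumOfReduced.of_directSum (κ := Σ i, Fin (n i)) (fun p => B p.1 p.2)
    ⟨fun x => (LinearEquiv.piCongrRight fun i => e i x).trans
      (LinearEquiv.piCurry K fun i j => (QRep.charrep K (B i j).2).obj x).symm, fun a m => ?_⟩
  funext p
  exact congrFun (he p.1 a (m p.1)) p.2

end SumOfReduced

/-! ### Linearizations of sets with partial maps -/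

section Lin

universe w₁ w₂ w₃ w₄

variable {K : Type v} [Field K] {Q : FinQuiver.{u}}

/-- A presentation of a representation as the linearization of a family of sets `X y` with partial
maps between them: every `V_y` has a basis indexed by `X y`, and the map of an arrow `a` sends the
basis vector of `s` to that of `s'` if `R a s s'`, and to `0` if there is no such `s'`. -/
structure Linearization (V : QRep.{u, v, w₁} K Q) (X : Q.V → Type w₂)
    (R : ∀ a, X (Q.t a) → X (Q.h a) → Prop) where
  basis : ∀ y, Module.Basis (X y) K (V.obj y)
  map_of_rel : ∀ a s s', R a s s' → V.map a (basis _ s) = basis _ s'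
  map_of_not : ∀ a s, (∀ s', ¬ R a s s') → V.map a (basis _ s) = 0

lemma Linearization.isIso {V : QRep.{u, v, w₁} K Q} {W : QRep.{u, v, w₂} K Q}
    {X : Q.V → Type w₃} {R : ∀ a, X (Q.t a) → X (Q.h a) → Prop}
    {Y : Q.V → Type w₄} {S : ∀ a, Y (Q.t a) → Y (Q.h a) → Prop}
    (hV : Linearization V X R) (hW : Linearization W Y S) (e : ∀ y, X y ≃ Y y)
    (he : ∀ a s s', R a s s' ↔ S a (e _ s) (e _ s')) : IsIso V W := by
  refine ⟨fun y => (hV.basis y).equiv (hW.basis y) (e y), fun a m => ?_⟩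
  refine LinearMap.congr_fun (f := ((hV.basis _).equiv (hW.basis _) (e _)).toLinearMap ∘ₗ V.map a)
    (g := W.map a ∘ₗ ((hV.basis _).equiv (hW.basis _) (e _)).toLinearMap)
    ((hV.basis _).ext fun s => ?_) m
  simp only [LinearMap.comp_apply, LinearEquiv.coe_coe, Module.Basis.equiv_apply]
  by_cases h : ∃ s', R a s s'
  · obtain ⟨s', h⟩ := h
    rw [hV.map_of_rel a s s' h, hW.map_of_rel a _ _ ((he _ _ _).1 h), Module.Basis.equiv_apply]
  · rw [hV.map_of_not a s fun s' hs => h ⟨s', hs⟩, map_zero, hW.map_of_not a]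
    intro s' hs
    refine h ⟨(e _).symm s', (he _ _ _).2 ?_⟩
    rwa [Equiv.apply_symm_apply]

/-- The tensor product of two linearizations is the linearization of the fibrewise product. -/
noncomputable def Linearization.tensor {V : QRep.{u, v, w₁} K Q} {W : QRep.{u, v, w₂} K Q}
    {X : Q.V → Type w₃} {R : ∀ a, X (Q.t a) → X (Q.h a) → Prop}
    {Y : Q.V → Type w₄} {S : ∀ a, Y (Q.t a) → Y (Q.h a) → Prop}
    (hV : Linearization V X R) (hW : Linearization W Y S) :
    Linearization (V.tensor W) (fun y => X y × Y y) fun a s s' => R a s.1 s'.1 ∧ S a s.2 s'.2 where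
  basis y := (hV.basis y).tensorProduct (hW.basis y)
  map_of_rel := by
    rintro a ⟨s, r⟩ ⟨s', r'⟩ ⟨h, h'⟩
    refine (congrArg (TensorProduct.map (V.map a) (W.map a))
      (Module.Basis.tensorProduct_apply (hV.basis _) (hW.basis _) s r)).trans
      (Eq.trans ?_ (Module.Basis.tensorProduct_apply (hV.basis _) (hW.basis _) s' r').symm)
    rw [TensorProduct.map_tmul, hV.map_of_rel a _ _ h, hW.map_of_rel a _ _ h']
  map_of_not := by
    rintro a ⟨s, r⟩ h
    refine (congrArg (TensorProduct.map (V.map a) (W.map a))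
      (Module.Basis.tensorProduct_apply (hV.basis _) (hW.basis _) s r)).trans ?_
    rw [TensorProduct.map_tmul]
    by_cases h1 : ∃ s', R a s s'
    · obtain ⟨s', h1⟩ := h1
      rw [hW.map_of_not a r fun r' hr => h (s', r') ⟨h1, hr⟩, TensorProduct.tmul_zero]
      rfl
    · rw [hV.map_of_not a s fun s' hs => h1 ⟨s', hs⟩, TensorProduct.zero_tmul]
      rfl

variable {Λ : FinQuiver.{u}}

open Classical in
lemma pushforward_map_apply (c : QHom Λ Q) (V : QRep.{u, v, w₁} K Λ) (a : Q.A)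
    (m : (pushforward c V).obj (Q.t a)) :
    letI := Fintype.ofFinite {b : Λ.A // c.onA b = a}
    (pushforward c V).map a m = ∑ b : {b : Λ.A // c.onA b = a},
      (Pi.single (M := fun y : {y : Λ.V // c.onV y = Q.h a} => V.obj y.1)
        ⟨Λ.h b.1, by rw [← c.map_h, b.2]⟩
        (V.map b.1 (m ⟨Λ.t b.1, by rw [← c.map_t, b.2]⟩)) :
          ∀ y : {y : Λ.V // c.onV y = Q.h a}, V.obj y.1) :=
  letI := Fintype.ofFinite {b : Λ.A // c.onA b = a}
  LinearMap.sum_apply Finset.univ (fun b : {b : Λ.A // c.onA b = a} =>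
    LinearMap.single K (fun y : {y : Λ.V // c.onV y = Q.h a} => V.obj y.1)
      ⟨Λ.h b.1, by rw [← c.map_h, b.2]⟩ ∘ₗ V.map b.1 ∘ₗ
      LinearMap.proj (φ := fun y : {y : Λ.V // c.onV y = Q.t a} => V.obj y.1)
        ⟨Λ.t b.1, by rw [← c.map_t, b.2]⟩) m

open Classical in
lemma pushforward_map_single (c : QHom Λ Q) (ht : Function.Injective Λ.t)
    (V : QRep.{u, v, w₁} K Λ) (b : Λ.A) (v : V.obj (Λ.t b)) :
    (pushforward c V).map (c.onA b)
        (Pi.single (M := fun y : {y : Λ.V // c.onV y = Q.t (c.onA b)} => V.obj y.1)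
          ⟨Λ.t b, (c.map_t b).symm⟩ v) =
      Pi.single (M := fun y : {y : Λ.V // c.onV y = Q.h (c.onA b)} => V.obj y.1)
        ⟨Λ.h b, (c.map_h b).symm⟩ (V.map b v) := by
  refine (pushforward_map_apply c V _ _).trans ?_
  let _ := Fintype.ofFinite {b' : Λ.A // c.onA b' = c.onA b}
  rw [Finset.sum_eq_single ⟨b, rfl⟩]
  · rw [Pi.single_eq_same]
  · rintro ⟨b', hb'⟩ - hne
    rw [Pi.single_eq_of_ne, map_zero, Pi.single_zero]
    intro h
    exact hne (Subtype.ext (ht (congrArg Subtype.val h)))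
  · exact fun h => (h (Finset.mem_univ _)).elim

open Classical in
lemma pushforward_map_single_of_forall_ne (c : QHom Λ Q) (V : QRep.{u, v, w₁} K Λ) (a : Q.A)
    (z : {y : Λ.V // c.onV y = Q.t a}) (hz : ∀ b, c.onA b = a → Λ.t b ≠ z.1) (v : V.obj z.1) :
    (pushforward c V).map a
        (Pi.single (M := fun y : {y : Λ.V // c.onV y = Q.t a} => V.obj y.1) z v) = 0 := by
  refine (pushforward_map_apply c V _ _).trans ?_
  let _ := Fintype.ofFinite {b' : Λ.A // c.onA b' = a}
  refine Finset.sum_eq_zero ?_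
  rintro ⟨b', hb'⟩ -
  rw [Pi.single_eq_of_ne, map_zero, Pi.single_zero]
  · rfl
  · intro h
    have h' := congrArg Subtype.val h
    exact hz b' hb' h'

/-- The pushforward of a linearization along a quiver morphism whose source has no two arrows with
the same tail. -/
noncomputable def Linearization.pushforward (c : QHom Λ Q) (ht : Function.Injective Λ.t)
    {V : QRep.{u, v, w₁} K Λ} {X : Λ.V → Type w₂} {R : ∀ a, X (Λ.t a) → X (Λ.h a) → Prop}
    (hV : Linearization V X R) :
    Linearization (pushforward c V) (fun y => Σ z : {z // c.onV z = y}, X z.1)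
      fun a s s' => ∃ (b : Λ.A) (hb : c.onA b = a) (r : X (Λ.t b)) (r' : X (Λ.h b)), R b r r' ∧
        s = ⟨⟨Λ.t b, by rw [← c.map_t, hb]⟩, r⟩ ∧ s' = ⟨⟨Λ.h b, by rw [← c.map_h, hb]⟩, r'⟩ where
  basis y :=
    letI := Fintype.ofFinite {z // c.onV z = y}
    Pi.basis fun z => hV.basis z.1
  map_of_rel := by
    classical
    rintro a _ _ ⟨b, rfl, r, r', h, rfl, rfl⟩
    let _ := Fintype.ofFinite {z // c.onV z = Q.t (c.onA b)}
    let _ := Fintype.ofFinite {z // c.onV z = Q.h (c.onA b)}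
    refine (congrArg ((QRep.pushforward c V).map (c.onA b)) (Pi.basis_apply _ _)).trans
      (Eq.trans ?_ (Pi.basis_apply _ _).symm)
    have := pushforward_map_single c ht V b (hV.basis _ r)
    rw [hV.map_of_rel b r r' h] at this
    exact this
  map_of_not := by
    classical
    rintro a ⟨z, r⟩ h
    let _ := Fintype.ofFinite {z // c.onV z = Q.t a}
    refine (congrArg ((QRep.pushforward c V).map a) (Pi.basis_apply _ _)).trans ?_
    by_cases hb : ∃ b, c.onA b = a ∧ Λ.t b = z.1
    · obtain ⟨b, rfl, hb⟩ := hb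
      obtain ⟨_, hz⟩ := z
      subst hb
      have := pushforward_map_single c ht V b (hV.basis _ r)
      rw [hV.map_of_not b r fun r' hr => h _ ⟨b, rfl, r, r', hr, rfl, rfl⟩, Pi.single_zero] at this
      exact this
    · have := pushforward_map_single_of_forall_ne c V a z (fun b hb' h => hb ⟨b, hb', h⟩)
        (hV.basis _ r)
      exact this

/-- The arrows of the pushforward of the identity representation along `c`, as a relation between
the fibres of `c`. -/
def fibreRel (c : QHom Λ Q) (a : Q.A) (s : {z // c.onV z = Q.t a}) (s' : {z // c.onV z = Q.h a}) :
    Prop :=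
  ∃ b, c.onA b = a ∧ Λ.t b = s.1 ∧ Λ.h b = s'.1

/-- The pushforward of the identity representation along `c`. -/
noncomputable abbrev linRep (K : Type v) [Field K] (c : QHom Λ Q) : QRep.{u, v, max u v} K Q :=
  QRep.pushforward c (one K Λ)

/-- The pushforward of the identity representation along `c` is the linearization of the fibres
of `c`, with the standard bases. -/
noncomputable def linearizationFibre (c : QHom Λ Q) (ht : Function.Injective Λ.t) :
    Linearization (linRep K c) (fun y => {z // c.onV z = y}) (fibreRel c) where
  basis y := Pi.basisFun K _
  map_of_rel := by
    classical
    rintro a ⟨_, hs⟩ ⟨_, hs'⟩ ⟨b, rfl, rfl, rfl⟩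
    refine (congrArg ((linRep K c).map (c.onA b)) (Pi.basisFun_apply _ _ _)).trans
      (Eq.trans ?_ (Pi.basisFun_apply _ _ _).symm)
    exact pushforward_map_single c ht (one K Λ) b (1 : K)
  map_of_not := by
    classical
    rintro a z h
    refine (congrArg ((linRep K c).map a) (Pi.basisFun_apply _ _ _)).trans ?_
    exact pushforward_map_single_of_forall_ne c (one K Λ) a z
      (fun b hb hz => h ⟨Λ.h b, by rw [← c.map_h, hb]⟩ ⟨b, hb, hz, rfl⟩) (1 : K)

lemma cast_basis_linearizationFibre (c : QHom Λ Q) (ht : Function.Injective Λ.t) {x y : Q.V}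
    (h : x = y) (s : {z // c.onV z = x}) :
    LinearEquiv.cast (R := K) (M := (linRep K c).obj) h
        ((linearizationFibre (K := K) c ht).basis x s) =
      (linearizationFibre c ht).basis y ⟨s.1, s.2.trans h⟩ := by
  subst h
  rfl

/-- The pullback along `c` of the linearization of the fibres of `d` is the linearization of the
fibres of `d` over the image of `c`. -/
noncomputable def linearizationPullback {Γ : FinQuiver.{u}} (c : QHom Λ Q) (d : QHom Γ Q)
    (ht : Function.Injective Γ.t) :
    Linearization (pullback c (linRep K d)) (fun y => {z // d.onV z = c.onV y})
      fun a s s' => ∃ b, d.onA b = c.onA a ∧ Γ.t b = s.1 ∧ Γ.h b = s'.1 where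
  basis y := (linearizationFibre d ht).basis (c.onV y)
  map_of_rel := by
    rintro a s s' ⟨b, hb, hs, hs'⟩
    refine (congrArg (fun m => LinearEquiv.cast (R := K) (M := (linRep K d).obj) (c.map_h a)
      ((linRep K d).map (c.onA a) m)) (cast_basis_linearizationFibre d ht (c.map_t a).symm s)).trans
      (Eq.trans (congrArg (LinearEquiv.cast (R := K) (M := (linRep K d).obj) (c.map_h a)) ?_)
        (cast_basis_linearizationFibre d ht (c.map_h a) ⟨s'.1, s'.2.trans (c.map_h a).symm⟩))
    exact (linearizationFibre d ht).map_of_rel _ _ _ ⟨b, hb, hs, hs'⟩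
  map_of_not := by
    rintro a s h
    refine (congrArg (fun m => LinearEquiv.cast (R := K) (M := (linRep K d).obj) (c.map_h a)
      ((linRep K d).map (c.onA a) m)) (cast_basis_linearizationFibre d ht (c.map_t a).symm s)).trans
      (Eq.trans (congrArg (LinearEquiv.cast (R := K) (M := (linRep K d).obj) (c.map_h a)) ?_)
        (map_zero _))
    refine (linearizationFibre d ht).map_of_not _ _ ?_
    rintro s' ⟨b, hb, hs, hs'⟩
    exact h ⟨s'.1, s'.2.trans (c.map_h a)⟩ ⟨b, hb, hs, hs'⟩

end Lin

/-! ### Tensor products, pullbacks and pushforwards of tree representations -/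

section Trees

variable {K : Type v} [Field K]

/-- The projection formula for identity representations, `c_* 1 ⊗ d_* 1 ≃ (c ×_Q d)_* 1`. -/
lemma tensor_isIso {Q : RootedTreeQuiver.{u}} {x : Q.V} (S T : TreeOver Q.toFinQuiver x) :
    IsIso ((linRep K S.str).tensor (linRep K T.str)) (linRep K (S.comp (S.prod T)).str) := by
  refine ((linearizationFibre S.str S.src.isRootedTree.t_injective).tensor
    (linearizationFibre T.str T.src.isRootedTree.t_injective)).isIso
    (linearizationFibre (S.comp (S.prod T)).str (S.prod T).src.isRootedTree.t_injective)
    (fun y =>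
      { toFun := fun p => ⟨⟨(p.1.1, p.2.1), p.1.2.trans p.2.2.symm⟩, p.1.2⟩
        invFun := fun p => (⟨p.1.1.1, p.2⟩, ⟨p.1.1.2, p.1.2.symm.trans p.2⟩)
        left_inv := fun p => rfl
        right_inv := fun p => rfl }) ?_
  rintro a ⟨s, r⟩ ⟨s', r'⟩
  constructor
  · rintro ⟨⟨b, hb, h1, h2⟩, ⟨b', hb', h1', h2'⟩⟩
    exact ⟨⟨(b, b'), hb.trans hb'.symm⟩, hb, Subtype.ext (Prod.ext h1 h1'),
      Subtype.ext (Prod.ext h2 h2')⟩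
  · rintro ⟨⟨⟨b, b'⟩, hb⟩, h, h1, h2⟩
    have h1' := congrArg Subtype.val h1
    have h2' := congrArg Subtype.val h2
    exact ⟨⟨b, h, congrArg Prod.fst h1', congrArg Prod.fst h2'⟩,
      ⟨b', hb.symm.trans h, congrArg Prod.snd h1', congrArg Prod.snd h2'⟩⟩

/-- Base change for identity representations. -/
lemma pullback_isIso {Q : RootedTreeQuiver.{u}} {x : Q.V} (S T : TreeOver Q.toFinQuiver x) :
    IsIso (pullback S.str (linRep K T.str)) (linRep K (S.prod T).str) := by
  refine (linearizationPullback S.str T.str T.src.isRootedTree.t_injective).isIso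
    (linearizationFibre (S.prod T).str (S.prod T).src.isRootedTree.t_injective)
    (fun y =>
      { toFun := fun p => ⟨⟨(y, p.1), p.2.symm⟩, rfl⟩
        invFun := fun p => ⟨p.1.1.2, p.1.2.symm.trans (congrArg S.str.onV p.2)⟩
        left_inv := fun p => rfl
        right_inv := by
          rintro ⟨⟨⟨y', z⟩, h⟩, hy⟩
          obtain rfl : y' = y := hy
          rfl }) ?_
  rintro a s s'
  constructor
  · rintro ⟨b, hb, h1, h2⟩
    exact ⟨⟨(a, b), hb.symm⟩, rfl, Subtype.ext (Prod.ext rfl h1), Subtype.ext (Prod.ext rfl h2)⟩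
  · rintro ⟨⟨⟨a', b⟩, hb⟩, h, h1, h2⟩
    obtain rfl : a' = a := h
    exact ⟨b, hb.symm, congrArg (fun p => p.1.2) h1, congrArg (fun p => p.1.2) h2⟩

/-- Pushforward is functorial on identity representations. -/
lemma pushforward_isIso {Q : FinQuiver.{u}} {x : Q.V} (T : TreeOver Q x)
    (S : TreeOver T.src.toFinQuiver T.src.root) :
    IsIso (pushforward T.str (linRep K S.str)) (linRep K (T.comp S).str) := by
  have key : ∀ {w y y' : _} (e : y = y') (hy : T.str.onV y = w) (hy' : T.str.onV y' = w) z
      (hz : S.str.onV z = y) (hz' : S.str.onV z = y'),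
      (⟨⟨y, hy⟩, ⟨z, hz⟩⟩ : Σ p : {p // T.str.onV p = w}, {z // S.str.onV z = p.1}) =
        ⟨⟨y', hy'⟩, ⟨z, hz'⟩⟩ := by
    rintro w y _ rfl hy hy' z hz hz'
    rfl
  refine ((linearizationFibre S.str S.src.isRootedTree.t_injective).pushforward T.str
    T.src.isRootedTree.t_injective).isIso
    (linearizationFibre (T.comp S).str S.src.isRootedTree.t_injective)
    (fun y =>
      { toFun := fun p => ⟨p.2.1, (congrArg T.str.onV p.2.2).trans p.1.2⟩
        invFun := fun p => ⟨⟨S.str.onV p.1, p.2⟩, ⟨p.1, rfl⟩⟩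
        left_inv := by
          rintro ⟨⟨y, h⟩, ⟨z, hz⟩⟩
          change S.str.onV z = y at hz
          subst hz
          rfl
        right_inv := fun p => rfl }) ?_
  rintro a s s'
  constructor
  · rintro ⟨b, hb, r, r', ⟨c, hc, h1, h2⟩, rfl, rfl⟩
    exact ⟨c, (congrArg T.str.onA hc).trans hb, h1, h2⟩
  · rintro ⟨c, hc, h1, h2⟩
    refine ⟨S.str.onA c, hc, ⟨S.src.t c, (S.str.map_t c).symm⟩,
      ⟨S.src.h c, (S.str.map_h c).symm⟩, ⟨c, rfl, rfl, rfl⟩, ?_, ?_⟩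
    · obtain ⟨⟨y, hy⟩, ⟨z, hz⟩⟩ := s
      obtain rfl : S.src.t c = z := h1
      exact key (hz.symm.trans (S.str.map_t c).symm) _ _ _ _ _
    · obtain ⟨⟨y, hy⟩, ⟨z, hz⟩⟩ := s'
      obtain rfl : S.src.h c = z := h2
      exact key (hz.symm.trans (S.str.map_h c).symm) _ _ _ _ _

/-- A bijective morphism over `Q` induces an isomorphism of the pushforwards of the identity
representations. -/
lemma linRep_isIso_of_bijective {Q Λ Γ : FinQuiver.{u}} {c : QHom Λ Q} {d : QHom Γ Q}
    (f : QHom Λ Γ) (hf : f.comp d = c) (hV : Function.Bijective f.onV)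
    (hA : Function.Bijective f.onA) (ht : Function.Injective Λ.t)
    (ht' : Function.Injective Γ.t) : IsIso (linRep K c) (linRep K d) := by
  subst hf
  refine (linearizationFibre (f.comp d) ht).isIso (linearizationFibre d ht')
    (fun y => Equiv.subtypeEquiv (Equiv.ofBijective _ hV) fun z => Iff.rfl) ?_
  rintro a s s'
  constructor
  · rintro ⟨b, hb, h1, h2⟩
    exact ⟨f.onA b, hb, (f.map_t b).trans (congrArg f.onV h1),
      (f.map_h b).trans (congrArg f.onV h2)⟩
  · rintro ⟨b, hb, h1, h2⟩
    obtain ⟨b, rfl⟩ := hA.2 b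
    exact ⟨b, hb, hV.1 ((f.map_t b).symm.trans h1), hV.1 ((f.map_h b).symm.trans h2)⟩

end Trees

/-! ### Splitting the representation of a join -/

section Split

/-- Let `ret : ι → J` have the section `sec`. If `g i j : C i → D j` vanishes unless `ret i = j`
and is bijective for `i = sec j`, then the map `(c_i)_i ↦ (∑_i g i j (c_i))_j` identifies the sum of
the `C i` over the image of `sec` with the sum of the `D j`. Here every `C i` appears as a direct
summand of some `W i`. -/
lemma exists_splitEquiv {K : Type v} [Field K] {ι J : Type u} [Fintype ι]
    {W C U : ι → Type w} {D : J → Type w}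
    [∀ i : ι, AddCommGroup (W i)] [∀ i : ι, AddCommGroup (C i)] [∀ j : J, AddCommGroup (D j)]
    [∀ i : ι, AddCommGroup (U i)] [∀ i, Module K (W i)] [∀ i, Module K (C i)]
    [∀ i, Module K (D i)] [∀ i, Module K (U i)] (ret : ι → J) (sec : J → ι)
    (hsec : ∀ j, ret (sec j) = j) (e : ∀ i, W i ≃ₗ[K] C i × U i) (g : ∀ i j, C i →ₗ[K] D j)
    (hg0 : ∀ i j, ret i ≠ j → g i j = 0) (hg : ∀ j, Function.Bijective (g (sec j) j)) :
    ∃ E : (∀ i, W i) ≃ₗ[K] (∀ j, D j) × ((∀ i : {i // i ∉ Set.range sec}, C i.1) × ∀ i, U i),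
      ∀ w, E w = (fun j => ∑ i, g i j (e i (w i)).1,
        fun i : {i // i ∉ Set.range sec} => (e i.1 (w i.1)).1, fun i => (e i (w i)).2) := by
  classical
  let f : (∀ i, W i) →ₗ[K] (∀ j, D j) × ((∀ i : {i // i ∉ Set.range sec}, C i.1) × ∀ i, U i) :=
    { toFun := fun w => (fun j => ∑ i, g i j (e i (w i)).1,
        fun i : {i // i ∉ Set.range sec} => (e i.1 (w i.1)).1, fun i => (e i (w i)).2)
      map_add' := fun w w' => by
        refine Prod.ext (funext fun j => ?_) (Prod.ext (funext fun i => ?_) (funext fun i => ?_))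
          <;> simp [Finset.sum_add_distrib]
      map_smul' := fun r w => by
        refine Prod.ext (funext fun j => ?_) (Prod.ext (funext fun i => ?_) (funext fun i => ?_))
          <;> simp [Finset.smul_sum] }
  -- among the indices in the image of `sec`, only `sec j` contributes to the coordinate `j`
  have hsum : ∀ (c : ∀ i, C i) (j : J), ∑ i, g i j (c i) =
      g (sec j) j (c (sec j)) + ∑ i with i ∉ Set.range sec, g i j (c i) := by
    intro c j
    rw [← Finset.sum_filter_add_sum_filter_not Finset.univ (· ∈ Set.range sec)]
    congr 1
    refine Finset.sum_eq_single_of_mem _ (by simp) ?_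
    intro i hi hne
    obtain ⟨j', rfl⟩ := (Finset.mem_filter.1 hi).2
    rw [hg0 _ _ fun h => hne ?_, LinearMap.zero_apply]
    rw [← h, hsec]
  refine ⟨LinearEquiv.ofBijective f ⟨?_, ?_⟩, fun w => rfl⟩
  · rw [← LinearMap.ker_eq_bot, LinearMap.ker_eq_bot']
    intro w hw
    have h1 : ∀ j, ∑ i, g i j (e i (w i)).1 = 0 := fun j => congrFun (congrArg Prod.fst hw) j
    have h2 : ∀ i, i ∉ Set.range sec → (e i (w i)).1 = 0 := fun i hi =>
      congrFun (congrArg (fun p => p.2.1) hw) ⟨i, hi⟩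
    have h3 : ∀ i, (e i (w i)).2 = 0 := fun i => congrFun (congrArg (fun p => p.2.2) hw) i
    funext i
    refine (e i).map_eq_zero_iff.1 (Prod.ext ?_ (h3 i))
    by_cases hi : i ∈ Set.range sec
    · obtain ⟨j, rfl⟩ := hi
      have := h1 j
      rw [hsum (fun i => (e i (w i)).1), Finset.sum_eq_zero, add_zero] at this
      · exact (hg j).1 (this.trans (map_zero _).symm)
      · intro i hi
        rw [h2 i (Finset.mem_filter.1 hi).2, map_zero]
    · exact h2 i hi
  · rintro ⟨d, c, u⟩
    let c₀ : ∀ i, C i := fun i => if h : i ∉ Set.range sec then c ⟨i, h⟩ else 0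
    choose b hb using fun j => (hg j).2 (d j - ∑ i with i ∉ Set.range sec, g i j (c₀ i))
    have hex : ∀ i, ∃ y : C i, (∀ j, sec j = i → g i j y =
        d j - ∑ i with i ∉ Set.range sec, g i j (c₀ i)) ∧
        (∀ h : i ∉ Set.range sec, y = c ⟨i, h⟩) := by
      intro i
      by_cases hi : i ∈ Set.range sec
      · obtain ⟨j, rfl⟩ := hi
        refine ⟨b j, fun j' hj' => ?_, fun h => (h ⟨j, rfl⟩).elim⟩
        obtain rfl : j' = j := by rw [← hsec j', hj', hsec]
        exact hb j'
      · exact ⟨c ⟨i, hi⟩, fun j hj => (hi ⟨j, hj⟩).elim, fun _ => rfl⟩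
    choose y hy hy' using hex
    refine ⟨fun i => (e i).symm (y i, u i), ?_⟩
    refine Prod.ext (funext fun j => ?_) (Prod.ext (funext fun i => ?_) (funext fun i => ?_))
    · change ∑ i, g i j (e i ((e i).symm (y i, u i))).1 = d j
      simp only [LinearEquiv.apply_symm_apply]
      rw [hsum y, hy (sec j) j rfl, sub_add_eq_add_sub, sub_eq_iff_eq_add]
      congr 1
      refine Finset.sum_congr rfl fun i hi => ?_
      have hi := (Finset.mem_filter.1 hi).2
      rw [hy' i hi]
      rw [show c₀ i = c ⟨i, hi⟩ from dif_pos hi]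
    · change (e i.1 ((e i.1).symm (y i.1, u i.1))).1 = c i
      rw [LinearEquiv.apply_symm_apply]
      exact hy' i.1 i.2
    · change (e i ((e i).symm (y i, u i))).2 = u i
      rw [LinearEquiv.apply_symm_apply]

end Split

section Join

variable {K : Type v} [Field K] {Q : FinQuiver.{u}}

open Classical in
lemma linRep_map_apply {Λ : FinQuiver.{u}} [Fintype Λ.A] (c : QHom Λ Q) (a : Q.A)
    (m : (linRep K c).obj (Q.t a)) (w : {z // c.onV z = Q.h a}) :
    (show {z // c.onV z = Q.h a} → K from (linRep K c).map a m) w =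
      ∑ b : Λ.A, if h : c.onA b = a ∧ Λ.h b = w.1 then
        (show {z // c.onV z = Q.t a} → K from m) ⟨Λ.t b, by rw [← c.map_t, h.1]⟩ else 0 := by
  let _ := Fintype.ofFinite {b : Λ.A // c.onA b = a}
  rw [← Finset.sum_filter_of_ne (p := fun b => c.onA b = a), Finset.sum_subtype (p := fun b =>
    c.onA b = a) _ (fun b => by simp)]
  · refine (congrFun (pushforward_map_apply c (one K Λ) a m) w).trans ?_
    rw [Finset.sum_apply]
    refine Finset.sum_congr rfl fun b _ => ?_
    by_cases hb : Λ.h b.1 = w.1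
    · obtain ⟨w, hw⟩ := w
      obtain rfl : Λ.h b.1 = w := hb
      rw [Pi.single_eq_same, dif_pos ⟨b.2, rfl⟩]
      rfl
    · rw [Pi.single_eq_of_ne, dif_neg fun h => hb h.2]
      · rfl
      · exact fun h => hb (congrArg Subtype.val h).symm
  · intro b _ h
    by_contra hb
    exact h (dif_neg fun h => hb h.1)

/-- The coordinate at the root of the pushforward of the identity representation of a tree over
`Q`, as a functional on the space at the vertex `x` below the root. The vertex is allowed to be
given as some `y` with `y = x`. -/
def rootCoord {x : Q.V} (T : TreeOver Q x) {y : Q.V} (h : y = x) :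
    (linRep K T.str).obj y →ₗ[K] K :=
  LinearMap.proj (φ := fun _ => K)
    (⟨T.src.root, T.str_root.trans h.symm⟩ : {z // T.str.onV z = y})

variable {x : Q.V} {ι : Type u} [Finite ι] (arr : ι → Q.In x)
  (T : ∀ i, TreeOver Q (Q.t (arr i).1))

/-- The fibre of a join consists of the fibres of the joined trees and, over `x`, the new root. -/
def joinEquiv (y : Q.V) : (linRep K (TreeOver.join x arr T).str).obj y ≃ₗ[K]
    (∀ i, (linRep K (T i).str).obj y) × (PLift (y = x) → K) where
  toFun m := (fun i z => m ⟨some ⟨i, z.1⟩, z.2⟩, fun h => m ⟨none, h.down.symm⟩)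
  invFun p := fun
    | ⟨none, h⟩ => p.2 ⟨h.symm⟩
    | ⟨some z, h⟩ => p.1 z.1 ⟨z.2, h⟩
  map_add' _ _ := rfl
  map_smul' _ _ := rfl
  left_inv m := by
    funext z
    rcases z with ⟨_ | z, h⟩ <;> rfl
  right_inv _ := rfl

open Classical in
/-- The functional through which the maps of the new arrows of a join are given: the sum of the
root coordinates of the trees attached by an arrow over `a`. -/
noncomputable def joinForm (a : Q.In x) :
    (∀ i, (linRep K (T i).str).obj (Q.t a.1)) →ₗ[K] K :=
  letI := Fintype.ofFinite ι
  ∑ i, if h : arr i = a then rootCoord (T i) (by rw [h]) ∘ₗ LinearMap.proj i else 0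

/-- The map of an arrow on a join: it acts on the joined trees, and the arrows with head `x` also
have a component to the new root. -/
lemma joinEquiv_map (a : Q.A)
    (m : (linRep K (TreeOver.join x arr T).str).obj (Q.t a)) :
    joinEquiv arr T _ ((linRep K (TreeOver.join x arr T).str).map a m) =
      (fun i => (linRep K (T i).str).map a ((joinEquiv arr T _ m).1 i),
        fun h => joinForm arr T ⟨a, h.down⟩ (joinEquiv arr T _ m).1) := by
  classical
  let _ := Fintype.ofFinite ι
  let _ := fun i => Fintype.ofFinite (T i).src.A
  let _ : Fintype (TreeOver.join x arr T).src.A :=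
    inferInstanceAs (Fintype ((Σ i, (T i).src.A) ⊕ ι))
  refine Prod.ext (funext fun i => funext fun z => ?_) (funext fun h => ?_)
  · refine (linRep_map_apply (TreeOver.join x arr T).str a m ⟨some ⟨i, z.1⟩, z.2⟩).trans
      (Eq.trans ?_ (linRep_map_apply (T i).str a _ z).symm)
    refine (Fintype.sum_sum_type _).trans ?_
    rw [Finset.sum_eq_zero (s := (Finset.univ : Finset ι)), add_zero]
    · refine (Fintype.sum_sigma _).trans ((Finset.sum_eq_single i ?_ ?_).trans ?_)
      · intro i' _ hi'
        refine Finset.sum_eq_zero fun b _ => dif_neg ?_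
        rintro ⟨-, h⟩
        exact hi' (congrArg Sigma.fst (Option.some_injective _ h))
      · exact fun h => (h (Finset.mem_univ _)).elim
      · refine Finset.sum_congr rfl fun b _ => ?_
        by_cases hb : (T i).str.onA b = a ∧ (T i).src.h b = z.1
        · rw [dif_pos hb]
          refine (dif_pos ⟨hb.1, ?_⟩).trans rfl
          exact congrArg (fun z => some (Sigma.mk i z)) hb.2
        · rw [dif_neg hb]
          refine dif_neg ?_
          rintro ⟨h, h'⟩
          exact hb ⟨h, eq_of_heq (Sigma.mk.inj (Option.some_injective _ h')).2⟩
    · intro i' _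
      refine dif_neg ?_
      rintro ⟨-, h⟩
      exact Option.some_ne_none _ h.symm
  · refine (linRep_map_apply (TreeOver.join x arr T).str a m ⟨none, h.down.symm⟩).trans ?_
    refine (Fintype.sum_sum_type _).trans ?_
    rw [Finset.sum_eq_zero (s := (Finset.univ : Finset (Σ i, (T i).src.A))), zero_add]
    · refine Eq.trans ?_ (LinearMap.sum_apply _ _ _).symm
      refine Finset.sum_congr rfl fun i _ => ?_
      by_cases hi : arr i = ⟨a, h.down⟩
      · rw [dif_pos hi]
        exact dif_pos ⟨congrArg Subtype.val hi, rfl⟩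
      · rw [dif_neg hi]
        refine dif_neg ?_
        rintro ⟨h', -⟩
        exact hi (Subtype.ext h')
    · intro b _
      refine dif_neg ?_
      rintro ⟨-, h⟩
      exact Option.some_ne_none _ h

end Join

/-! ### The map induced by a morphism of trees -/

section PushMap

variable {K : Type v} [Field K]

/-- The map between pushforwards of identity representations induced by a morphism over `Q`: it
sends the basis vector of `z` to that of the image of `z`. -/
noncomputable def pushMap {Q : FinQuiver.{u}} {Λ Γ : RootedTreeQuiver.{u}}
    {c : QHom Λ.toFinQuiver Q} {d : QHom Γ.toFinQuiver Q}
    (f : QHom Λ.toFinQuiver Γ.toFinQuiver) (hf : f.comp d = c) (y : Q.V) :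
    (linRep K c).obj y →ₗ[K] (linRep K d).obj y :=
  ((linearizationFibre c Λ.isRootedTree.t_injective).basis y).constr K fun z =>
    (linearizationFibre d Γ.isRootedTree.t_injective).basis y
      ⟨f.onV z.1, (QHom.onV_of_comp_eq hf z.1).trans z.2⟩

lemma pushMap_basis {Q : FinQuiver.{u}} {Λ Γ : RootedTreeQuiver.{u}}
    {c : QHom Λ.toFinQuiver Q} {d : QHom Γ.toFinQuiver Q}
    (f : QHom Λ.toFinQuiver Γ.toFinQuiver) (hf : f.comp d = c) (y : Q.V)
    (z : {z // c.onV z = y}) :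
    pushMap (K := K) f hf y ((linearizationFibre c Λ.isRootedTree.t_injective).basis y z) =
      (linearizationFibre d Γ.isRootedTree.t_injective).basis y
        ⟨f.onV z.1, (QHom.onV_of_comp_eq hf z.1).trans z.2⟩ :=
  Module.Basis.constr_basis _ _ _ _

lemma pushMap_id {Q : FinQuiver.{u}} {Λ : RootedTreeQuiver.{u}}
    {c : QHom Λ.toFinQuiver Q} (y : Q.V) :
    pushMap (K := K) (c := c) (QHom.id _) rfl y = LinearMap.id :=
  ((linearizationFibre c Λ.isRootedTree.t_injective).basis y).ext fun z =>
    pushMap_basis (QHom.id _) rfl y z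

variable {Q : RootedTreeQuiver.{u}} {x : Q.V} {S T : TreeOver Q.toFinQuiver x}

/-- The induced maps commute with the maps of the arrows, because a morphism of trees over `Q`
preserves the root, the only vertex without an outgoing arrow. -/
lemma pushMap_map (f : QHom S.src.toFinQuiver T.src.toFinQuiver) (hf : f.comp T.str = S.str)
    (a : Q.A) (m : (linRep K S.str).obj (Q.t a)) :
    pushMap f hf _ ((linRep K S.str).map a m) = (linRep K T.str).map a (pushMap f hf _ m) := by
  let lS := linearizationFibre (K := K) S.str S.src.isRootedTree.t_injective
  let lT := linearizationFibre (K := K) T.str T.src.isRootedTree.t_injective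
  refine LinearMap.congr_fun (f := pushMap f hf _ ∘ₗ (linRep K S.str).map a)
    (g := (linRep K T.str).map a ∘ₗ pushMap f hf _) ((lS.basis _).ext fun z => ?_) m
  rw [LinearMap.comp_apply, LinearMap.comp_apply, pushMap_basis]
  by_cases h : ∃ z', fibreRel S.str a z z'
  · obtain ⟨z', b, hb, h1, h2⟩ := h
    rw [lS.map_of_rel a z z' ⟨b, hb, h1, h2⟩, pushMap_basis]
    refine (lT.map_of_rel a _ _ ⟨f.onA b, ?_, ?_, ?_⟩).symm
    · rw [QHom.onA_of_comp_eq hf, hb]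
    · rw [f.map_t, h1]
    · rw [f.map_h, h2]
  · rw [lS.map_of_not a z fun z' hz => h ⟨z', hz⟩, map_zero]
    refine (lT.map_of_not a _ ?_).symm
    rintro w ⟨b, hb, h1, -⟩
    have hz : z.1 ≠ S.src.root := by
      intro hz
      refine T.src.isRootedTree.t_ne_root b (h1.trans (T.eq_root ?_))
      change T.str.onV (f.onV z.1) = x
      rw [QHom.onV_of_comp_eq hf, hz, S.str_root]
    obtain ⟨b', hb'⟩ := S.src.isRootedTree.exists_arrow hz
    have hb'' : S.str.onA b' = a := by
      refine Q.isRootedTree.t_injective ?_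
      rw [S.str.map_t, hb', z.2]
    exact h ⟨⟨S.src.h b', by rw [← S.str.map_h, hb'']⟩, b', hb'', hb', rfl⟩

/-- The root coordinate is `1` on every basis vector, since the fibre of the root has only one
element. -/
lemma rootCoord_basis (T : TreeOver Q.toFinQuiver x) {y : Q.V} (h : y = x)
    (z : {z // T.str.onV z = y}) :
    rootCoord (K := K) T h ((linearizationFibre T.str T.src.isRootedTree.t_injective).basis y z) =
      1 := by
  classical
  obtain ⟨z, hz⟩ := z
  obtain rfl := T.eq_root (hz.trans h)
  refine (congrFun (Pi.basisFun_apply K _ _) _).trans ?_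
  exact Pi.single_eq_same _ _

lemma rootCoord_pushMap (f : QHom S.src.toFinQuiver T.src.toFinQuiver) (hf : f.comp T.str = S.str)
    {y : Q.V} (h : y = x) (m : (linRep K S.str).obj y) :
    rootCoord T h (pushMap f hf y m) = rootCoord S h m := by
  refine LinearMap.congr_fun (f := rootCoord T h ∘ₗ pushMap f hf y) (g := rootCoord S h)
    (((linearizationFibre S.str S.src.isRootedTree.t_injective).basis _).ext fun z => ?_) m
  rw [LinearMap.comp_apply, pushMap_basis, rootCoord_basis, rootCoord_basis]

end PushMap

/-! ### Decomposition into reduced representations -/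

section Decomp

variable {K : Type v} [Field K] {Q : RootedTreeQuiver.{u}}

/-- The pushforward of the identity representation of the tree `T` over `Q` is isomorphic to that
of `R` plus a sum of reduced representations, by an isomorphism that respects the root
coordinates. The latter is what makes it possible to join such isomorphisms at a new root. -/
def Decomp (K : Type v) [Field K] {x : Q.V} (T R : TreeOver Q.toFinQuiver x) : Prop :=
  ∃ U : QRep.{u, v, max u v} K Q.toFinQuiver, U.IsSumOfReduced ∧
    ∃ e : ∀ y, (linRep K T.str).obj y ≃ₗ[K] (linRep K R.str).obj y × U.obj y,
      (∀ a m, e _ ((linRep K T.str).map a m) =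
        ((linRep K R.str).map a (e _ m).1, U.map a (e _ m).2)) ∧
      ∀ m, rootCoord R rfl (e x m).1 = rootCoord T rfl m

variable {x : Q.V} {ι J : Type u}
  {arr : ι → Q.In x} {T R : ∀ i, TreeOver Q.toFinQuiver (Q.t (arr i).1)}
  {arrJ : J → Q.In x} {D : ∀ j, TreeOver Q.toFinQuiver (Q.t (arrJ j).1)}

/-- The matrix of maps to which `exists_splitEquiv` is applied: the entry at `(i, j)` is induced by
a morphism from `R i` to `D j` if `ret i = j`, and zero otherwise. For `i = sec j` the morphism is
an endomorphism of `D j`, hence the identity. -/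
lemma exists_pushMap (ret : ι → J) (sec : J → ι) (harr : ∀ i, arrJ (ret i) = arr i)
    (hret : ∀ i, HomOver (R i).str (D (ret i)).str)
    (hsec : ∀ j, (⟨arr (sec j), R (sec j)⟩ :
      Σ a : Q.In x, TreeOver Q.toFinQuiver (Q.t a.1)) = ⟨arrJ j, D j⟩)
    (hend : ∀ (j) (f : QHom (D j).src.toFinQuiver (D j).src.toFinQuiver),
      f.comp (D j).str = (D j).str → f = QHom.id _) (i : ι) (j : J) :
    ∃ g : ∀ y, (linRep K (R i).str).obj y →ₗ[K] (linRep K (D j).str).obj y,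
      (∀ a m, g _ ((linRep K (R i).str).map a m) = (linRep K (D j).str).map a (g _ m)) ∧
      (ret i ≠ j → ∀ y, g y = 0) ∧
      (ret i = j → ∀ (y : Q.V) (h : y = Q.t (arr i).1) (h' : y = Q.t (arrJ j).1) m,
        rootCoord (D j) h' (g y m) = rootCoord (R i) h m) ∧
      (ret i = j → i = sec j → ∀ y, Function.Bijective (g y)) := by
  by_cases hij : ret i = j
  · subst hij
    obtain ⟨f, hf⟩ := hret i
    have key : ∀ {a b : Q.In x} (hab : b = a) (R : TreeOver Q.toFinQuiver (Q.t a.1))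
        (D : TreeOver Q.toFinQuiver (Q.t b.1))
        (f : QHom R.src.toFinQuiver D.src.toFinQuiver) (hf : f.comp D.str = R.str),
        (∀ a m, pushMap f hf _ ((linRep K R.str).map a m) =
          (linRep K D.str).map a (pushMap f hf _ m)) ∧
        ∀ (y : Q.V) (h : y = Q.t a.1) (h' : y = Q.t b.1) m,
          rootCoord D h' (pushMap (K := K) f hf y m) = rootCoord R h m := by
      rintro a b rfl R D f hf
      exact ⟨pushMap_map f hf, fun y h _ m => rootCoord_pushMap f hf h m⟩
    have key' : ∀ (p q : Σ a : Q.In x, TreeOver Q.toFinQuiver (Q.t a.1)), p = q →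
        (∀ k : QHom q.2.src.toFinQuiver q.2.src.toFinQuiver, k.comp q.2.str = q.2.str →
          k = QHom.id _) →
        ∀ (f : QHom p.2.src.toFinQuiver q.2.src.toFinQuiver) (hf : f.comp q.2.str = p.2.str) y,
          Function.Bijective (pushMap (K := K) f hf y) := by
      rintro p _ rfl hk f hf y
      obtain rfl := hk f hf
      rw [pushMap_id]
      exact Function.bijective_id
    obtain ⟨h1, h2⟩ := key (harr i) (R i) (D (ret i)) f hf
    refine ⟨pushMap f hf, h1, fun h => (h rfl).elim, fun _ => h2, fun _ hi y => ?_⟩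
    refine key' ⟨arr i, R i⟩ ⟨arrJ (ret i), D (ret i)⟩ ?_ (hend _) f hf y
    have := hsec (ret i)
    rwa [← hi] at this
  · exact ⟨fun _ => 0, fun _ _ => by simp, fun _ _ => rfl, fun h => (hij h).elim,
      fun h => (hij h).elim⟩

/-- Decomposing a join: if each `T i` decomposes with main part `R i`, and `R i` maps to the tree
`D (ret i)`, with each `D j` being one of the `R i`, then the join of the `T i` decomposes with main
part the join of the `D j`. -/
lemma Decomp.join [Finite ι] [Finite J] (hT : ∀ i, Decomp K (T i) (R i))
    (hR : ∀ i, (linRep K (R i).str).IsSumOfReduced)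
    (ret : ι → J) (sec : J → ι) (harr : ∀ i, arrJ (ret i) = arr i)
    (hret : ∀ i, HomOver (R i).str (D (ret i)).str) (hrs : ∀ j, ret (sec j) = j)
    (hsec : ∀ j, (⟨arr (sec j), R (sec j)⟩ :
      Σ a : Q.In x, TreeOver Q.toFinQuiver (Q.t a.1)) = ⟨arrJ j, D j⟩)
    (hend : ∀ (j) (f : QHom (D j).src.toFinQuiver (D j).src.toFinQuiver),
      f.comp (D j).str = (D j).str → f = QHom.id _) :
    Decomp K (TreeOver.join x arr T) (TreeOver.join x arrJ D) := by
  classical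
  let _ := Fintype.ofFinite ι
  let _ := Fintype.ofFinite J
  choose U hU e he hroot using hT
  choose g hgmap hg0 hgroot hgbij using
    exists_pushMap (K := K) (R := R) (D := D) ret sec harr hret hsec hend
  choose E hE using fun y => exists_splitEquiv ret sec hrs (fun i => e i y) (fun i j => g i j y)
    (fun i j h => hg0 i j h y) fun j => hgbij (sec j) j (hrs j) rfl y
  -- the new arrows do not see the difference between the two sides of the splitting
  have hform : ∀ (a : Q.In x) (w : ∀ i, (linRep K (T i).str).obj (Q.t a.1)),
      joinForm arrJ D a (E _ w).1 = joinForm arr T a w := by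
    rintro a w
    rw [hE]
    refine (LinearMap.sum_apply _ _ _).trans (Eq.trans ?_ (LinearMap.sum_apply _ _ _).symm)
    have hD : ∀ j, (if h : arrJ j = a then rootCoord (D j) (by rw [h]) ∘ₗ LinearMap.proj j else 0 :
        (∀ j, (linRep K (D j).str).obj (Q.t a.1)) →ₗ[K] K)
          (fun j => ∑ i, g i j _ (e i _ (w i)).1) =
        ∑ i, if h : arrJ j = a then rootCoord (D j) (by rw [h]) (g i j _ (e i _ (w i)).1)
          else 0 := by
      intro j
      by_cases h : arrJ j = a
      · simp only [dif_pos h]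
        exact map_sum (rootCoord (D j) _) _ _
      · simp only [dif_neg h, LinearMap.zero_apply, Finset.sum_const_zero]
    refine (Finset.sum_congr rfl fun j _ => hD j).trans (Finset.sum_comm.trans ?_)
    refine Finset.sum_congr rfl fun i _ => ?_
    rw [Finset.sum_eq_single (ret i)]
    · by_cases h : arr i = a
      · subst h
        rw [dif_pos (harr i), dif_pos rfl]
        exact (hgroot i (ret i) rfl _ rfl _ _).trans (hroot i (w i))
      · rw [dif_neg h, dif_neg fun h' => h ((harr i).symm.trans h')]
        rfl
    · intro j _ hj
      rw [hg0 i j hj.symm]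
      split_ifs
      · exact map_zero _
      · rfl
    · exact fun h => (h (Finset.mem_univ _)).elim
  have hmap : ∀ (a : Q.A) (w : ∀ i, (linRep K (T i).str).obj (Q.t a)),
      E _ (fun i => (linRep K (T i).str).map a (w i)) =
        (fun j => (linRep K (D j).str).map a ((E _ w).1 j),
          fun i => (linRep K (R i.1).str).map a ((E _ w).2.1 i),
          fun i => (U i).map a ((E _ w).2.2 i)) := by
    intro a w
    simp only [hE, he, hgmap, map_sum]
  refine ⟨(QRep.directSum fun i : {i : ι // i ∉ Set.range sec} => linRep K (R i.1).str).oplus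
    (QRep.directSum U),
    (IsSumOfReduced.directSum fun i : {i : ι // i ∉ Set.range sec} => hR i.1).oplus
      (IsSumOfReduced.directSum hU), fun y =>
    (joinEquiv arr T y).trans (((E y).prodCongr (LinearEquiv.refl K _)).trans
      (((LinearEquiv.prodAssoc K _ _ _).trans
        ((LinearEquiv.refl K _).prodCongr (LinearEquiv.prodComm K _ _))).trans
        ((LinearEquiv.prodAssoc K _ _ _).symm.trans
        ((joinEquiv arrJ D y).symm.prodCongr (LinearEquiv.refl K _))))), ?_, ?_⟩
  · intro a m
    have hm := joinEquiv_map arr T a m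
    refine Prod.ext ((joinEquiv arrJ D _).injective ?_) ?_
    · refine ((joinEquiv arrJ D _).apply_symm_apply _).trans ?_
      refine Eq.trans ?_ (joinEquiv_map arrJ D a _).symm
      change ((E _ (joinEquiv arr T _ _).1).1, (joinEquiv arr T _ _).2) =
        ((fun j => (linRep K (D j).str).map a ((joinEquiv arrJ D _ ((joinEquiv arrJ D _).symm
          ((E _ (joinEquiv arr T _ m).1).1, (joinEquiv arr T _ m).2))).1 j)), fun h =>
          joinForm arrJ D ⟨a, h.down⟩ (joinEquiv arrJ D _ ((joinEquiv arrJ D _).symm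
          ((E _ (joinEquiv arr T _ m).1).1, (joinEquiv arr T _ m).2))).1)
      rw [LinearEquiv.apply_symm_apply]
      refine Prod.ext ?_ (funext fun h => (congrFun (congrArg Prod.snd hm) h).trans
        (hform ⟨a, h.down⟩ _).symm)
      exact (congrArg (fun p => (E _ p.1).1) hm).trans (congrArg Prod.fst (hmap a _))
    · change (E _ (joinEquiv arr T _ _).1).2 = _
      rw [hm, hmap]
      rfl
  · intro m
    rfl

/-- The space `U_x` of a complement vanishes: on `(T_* 1)_x` the root coordinate is injective. -/
lemma Decomp.exists_isIso {T R : TreeOver Q.toFinQuiver x} (h : Decomp K T R) :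
    ∃ U : QRep.{u, v, max u v} K Q.toFinQuiver, U.IsSumOfReduced ∧ x ∉ U.supp ∧
      IsIso (linRep K T.str) ((linRep K R.str).oplus U) := by
  obtain ⟨U, hU, e, he, hroot⟩ := h
  refine ⟨U, hU, fun hx => ?_, e, he⟩
  obtain ⟨u, hu⟩ := (nontrivial_iff_exists_ne (0 : U.obj x)).1 hx
  have h1 := hroot ((e x).symm (0, u))
  rw [LinearEquiv.apply_symm_apply, map_zero] at h1
  have h2 : (e x).symm (0, u) = 0 := by
    funext z
    obtain ⟨z, hz⟩ := z
    obtain rfl := T.eq_root hz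
    exact h1.symm
  exact hu (congrArg Prod.snd ((e x).symm.map_eq_zero_iff.1 h2))

lemma exists_decomp_of_joinBuilt (K : Type v) [Field K] {T : TreeOver Q.toFinQuiver x}
    (hT : T.JoinBuilt) :
    ∃ M : Q.L x, HomOver T.str (Q.reduced M).str ∧ HomOver (Q.reduced M).str T.str ∧
      Decomp K T (Q.reduced M) := by
  induction hT with
  | @join x ι _ arr T _ ih =>
    choose M hM hM' hdec using ih
    -- the element of `L_Q(x)` generated by the elements `M i` of the subtrees
    let lab : ι → Σ a : Q.In x, Q.L (Q.t a.1) := fun i => ⟨arr i, M i⟩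
    let P : ∀ a : Q.In x, LowerSet (Q.L (Q.t a.1)) := fun a =>
      ⟨{S | ∃ i S', lab i = ⟨a, S'⟩ ∧ S ≤ S'},
        fun S S₁ h => fun ⟨i, S', hi, hle⟩ => ⟨i, S', hi, h.trans hle⟩⟩
    let N : Q.L x := (Q.latticeEquiv x).symm P
    have hN : Q.latticeEquiv x N = P := (Q.latticeEquiv x).apply_symm_apply P
    have hsec : ∀ j : RootedTreeQuiver.MaxIndex N, ∃ i, lab i = ⟨j.1, j.2.1⟩ := by
      rintro ⟨a, S, hS⟩
      rw [hN] at hS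
      obtain ⟨i, S', hi, hle⟩ := hS.prop
      have : S' = S := le_antisymm (hS.le_of_ge ⟨i, S', hi, le_rfl⟩ hle) hle
      exact ⟨i, this ▸ hi⟩
    have hret : ∀ i, ∃ j : RootedTreeQuiver.MaxIndex N, j.1 = arr i ∧
        HomOver (Q.reduced (M i)).str (Q.reduced j.2.1).str := by
      intro i
      obtain ⟨S, hle, hS⟩ := (Set.toFinite {S | S ∈ Q.latticeEquiv x N (arr i)}).exists_le_maximal
        (a := M i) (by rw [hN]; exact ⟨i, M i, rfl, le_rfl⟩)
      exact ⟨⟨arr i, S, hS⟩, rfl, (RootedTreeQuiver.le_iff_homOver _ _).1 hle⟩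
    choose sec hsec using hsec
    choose ret harr hret using hret
    have hrs : ∀ j, ret (sec j) = j := by
      have key : ∀ (p q : Σ a : Q.In x, Q.L (Q.t a.1)) (a : Q.In x)
          (hq : Maximal (· ∈ Q.latticeEquiv x N q.1) q.2) (S : Q.L (Q.t a.1))
          (hS : Maximal (· ∈ Q.latticeEquiv x N a) S), p = q → a = p.1 →
          HomOver (Q.reduced p.2).str (Q.reduced S).str →
          (⟨a, S, hS⟩ : RootedTreeQuiver.MaxIndex N) = ⟨q.1, q.2, hq⟩ := by
        rintro p _ a hq S hS rfl rfl h
        have hle := (RootedTreeQuiver.le_iff_homOver _ _).2 h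
        have : S = p.2 := le_antisymm (hq.le_of_ge hS.prop hle) hle
        subst this
        rfl
      intro j
      exact key _ ⟨j.1, j.2.1⟩ _ j.2.2 _ (ret (sec j)).2.2 (hsec j) (harr (sec j))
        (hret (sec j))
    have heq : ∀ p q : Σ a : Q.In x, Q.L (Q.t a.1), p = q →
        HomOver (Q.reduced q.2).str (Q.reduced p.2).str := by
      rintro p _ rfl
      exact HomOver.refl _
    refine ⟨N, ?_, ?_, ?_⟩
    · rw [RootedTreeQuiver.reduced_eq N]
      exact homOver_join fun i => ⟨ret i, harr i, (hM i).trans (hret i)⟩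
    · rw [RootedTreeQuiver.reduced_eq N]
      exact homOver_join fun j => ⟨sec j, congrArg Sigma.fst (hsec j),
        (heq _ _ (hsec j)).trans (hM' (sec j))⟩
    · rw [RootedTreeQuiver.reduced_eq N]
      exact Decomp.join hdec (fun i => IsSumOfReduced.charrep (M i)) ret sec harr hret hrs
        (fun j => congrArg (fun p : Σ a : Q.In x, Q.L (Q.t a.1) =>
          (⟨p.1, Q.reduced p.2⟩ : Σ a : Q.In x, TreeOver Q.toFinQuiver (Q.t a.1))) (hsec j))
        (fun j f hf => RootedTreeQuiver.end_reduced _ f hf)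

/-- Every tree `T` over `Q` is rank equivalent to some reduced quiver `Q_M`, and the pushforward of
its identity representation is `1_M` plus a sum of reduced representations that vanish at the
vertex below the root. -/
theorem exists_reduced (K : Type v) [Field K] (T : TreeOver Q.toFinQuiver x) :
    ∃ M : Q.L x, HomOver T.str (Q.reduced M).str ∧ HomOver (Q.reduced M).str T.str ∧
      ∃ U : QRep.{u, v, max u v} K Q.toFinQuiver, U.IsSumOfReduced ∧ x ∉ U.supp ∧
        IsIso (linRep K T.str) ((charrep K M).oplus U) := by
  obtain ⟨T', hT', f, hf, hV, hA⟩ := exists_joinBuilt T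
  obtain ⟨M, h1, h2, h3⟩ := exists_decomp_of_joinBuilt K hT'
  obtain ⟨U, hU, hx, hiso⟩ := h3.exists_isIso
  exact ⟨M, (HomOver.of_bijective f hf hV hA).trans h1, h2.trans ⟨f, hf⟩, U, hU, hx,
    (linRep_isIso_of_bijective f hf hV hA T'.src.isRootedTree.t_injective
      T.src.isRootedTree.t_injective).symm.trans hiso⟩

end Decomp
end QRep

end RootedTreeReps

theorem theorem3 (K : Type v) [Field K] (Q : RootedTreeQuiver.{u}) :
    (∀ M : Q.L Q.root,
      ∃ (push : (redQuiver M).L (redQuiver M).root → Q.L Q.root)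
        (pull : Q.L Q.root → (redQuiver M).L (redQuiver M).root),
        IsAdjunctionOf M push pull ∧
        (∀ N : Q.L Q.root,
          ∃ U : QRep.{u, v, max u v} K (redQuiver M).toFinQuiver,
            U.IsSumOfReduced ∧
            (redQuiver M).root ∉ U.supp ∧
            QRep.IsIso (QRep.pullback (redMap M) (QRep.charrep K N))
              ((QRep.charrep K (pull N)).oplus U)) ∧
        (∀ A : (redQuiver M).L (redQuiver M).root,
          ∃ U : QRep.{u, v, max u v} K Q.toFinQuiver,
            U.IsSumOfReduced ∧
            Q.root ∉ U.supp ∧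
            QRep.IsIso (QRep.pushforward (redMap M) (QRep.charrep K A))
              ((QRep.charrep K (push A)).oplus U))) ∧
    (∀ (x : Q.V) (M N : Q.L x),
      ∃ U : QRep.{u, v, max u v} K Q.toFinQuiver,
        U.IsSumOfReduced ∧
        x ∉ U.supp ∧
        QRep.IsIso ((QRep.charrep K M).tensor (QRep.charrep K N))
          ((QRep.charrep K (M ⊓ N)).oplus U)) := by
  constructor
  · intro M
    choose push hp1 hp2 hp using fun A : (redQuiver M).L (redQuiver M).root =>
      QRep.exists_reduced K ((Q.reduced M).comp ((redQuiver M).reduced A))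
    choose pull hq1 hq2 hq using fun N : Q.L Q.root =>
      QRep.exists_reduced K ((Q.reduced M).prod (Q.reduced N))
    refine ⟨push, pull, ⟨fun A N => ?_, fun A N => ?_⟩, fun N => ?_, fun A => ?_⟩
    · refine (RootedTreeQuiver.rankEquiv_iff_homOver N _).trans ⟨fun h => ?_, ?_⟩
      · exact le_antisymm ((RootedTreeQuiver.le_iff_homOver _ _).2 (h.1.trans (hp1 A)))
          ((RootedTreeQuiver.le_iff_homOver _ _).2 ((hp2 A).trans h.2))
      · rintro rfl
        exact ⟨hp2 A, hp1 A⟩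
    · refine (RootedTreeQuiver.le_iff_homOver _ _).trans
        (Iff.trans ⟨fun h => ?_, fun h => ?_⟩ (RootedTreeQuiver.le_iff_homOver _ _).symm)
      · exact HomOver.trans ((homOver_fibreFst_iff _).2 ((hp1 A).trans h)) (hq1 N)
      · exact (hp2 A).trans ((homOver_fibreFst_iff _).1 (h.trans (hq2 N)))
    · obtain ⟨U, hU, hx, hiso⟩ := hq N
      exact ⟨U, hU, hx, (QRep.pullback_isIso (Q.reduced M) (Q.reduced N)).trans hiso⟩
    · obtain ⟨U, hU, hx, hiso⟩ := hp A
      exact ⟨U, hU, hx,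
        (QRep.pushforward_isIso (Q.reduced M) ((redQuiver M).reduced A)).trans hiso⟩
  · intro x M N
    obtain ⟨L, h1, h2, U, hU, hx, hiso⟩ :=
      QRep.exists_reduced K ((Q.reduced M).comp ((Q.reduced M).prod (Q.reduced N)))
    -- `L` has the universal property of the meet, by that of the fibre product
    have hL : L = M ⊓ N := by
      refine le_antisymm (le_inf ?_ ?_) ?_
      · exact (RootedTreeQuiver.le_iff_homOver _ _).2 (h2.trans ⟨fibreFst _ _, rfl⟩)
      · exact (RootedTreeQuiver.le_iff_homOver _ _).2
          (h2.trans ⟨fibreSnd _ _, (fibreFst_comp _ _).symm⟩)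
      · obtain ⟨g, hg⟩ := (RootedTreeQuiver.le_iff_homOver _ _).1 (inf_le_left : M ⊓ N ≤ M)
        have hN := (RootedTreeQuiver.le_iff_homOver _ _).1 (inf_le_right : M ⊓ N ≤ N)
        rw [← hg] at hN
        obtain ⟨k, rfl⟩ := (homOver_fibreFst_iff _).2 hN
        have hk : HomOver (Q.reduced (M ⊓ N)).str
            ((Q.reduced M).comp ((Q.reduced M).prod (Q.reduced N))).str := ⟨k, hg⟩
        exact (RootedTreeQuiver.le_iff_homOver _ _).2 (hk.trans h1)
    subst hL
    exact ⟨U, hU, hx, (QRep.tensor_isIso (Q.reduced M) (Q.reduced N)).trans hiso⟩
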